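/- Let $d\ge 2$, $p=\frac{2(d+1)}{d-1}$, $0<\sigma<\frac12$, $R>1$, and put $E=\frac{d-1}{2}\sigma-\frac{(d-1)(d+2)}{2(d+1)}$. Write $x=(x',x_d)\in\mathbb R^{d-1}\times\mathbb R$, let $B_r$ be the open ball of radius $r$ about the origin of $\mathbb R^d$, let $P^{d-1}=\{\xi_d=|\xi'|^2,\ |\xi_j|\le1\ (1\le j\le d-1)\}$, and let $d\omega=\sqrt{1+4|\xi'|^2}\,d\xi'$ be its surface measure. *The example.* For $l\in\mathbb Z^{d-1}$ let $Q_l=\prod_j(l_jR^{-\sigma}-R^{-1},\,l_jR^{-\sigma}+R^{-1})$. Let $h(\xi)=\sum_{1\le l_1,\dots,l_{d-1}<R^\sigma}1_{Q_l}(\xi')$ and $g(x)=\int h(\xi)e^{2\pi i x\cdot\xi}\,d\omega(\xi)$, so that $\hat g=h\,d\omega$. Let $\Lambda=\{(n_1R^\sigma,\dots,n_{d-1}R^\sigma,n_dR^{2\sigma}):n_j\in\mathbb Z\}$ and let $X=\{x\in B_R:\operatorname{dist}(x,\Lambda)<1\}$. *Caps and weights.* Divide $\mathbb R^{d-1}$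 into the cubes $\tau$ of a half-open axis-parallel grid, in any position, with side length $s\in[\frac12R^{-1/2},R^{-1/2}]$. The caps are the sets $\theta=\{\xi\in P^{d-1}:\xi'\in\tau\}$, and $g_\theta(x)=\int_\theta h(\xi)e^{2\pi ix\cdot\xi}\,d\omega(\xi)$. Call the grid *adapted* if for each $l$ in the sum, $Q_l\cap[-1,1]^{d-1}$ lies in one cube of the grid. Let $w$ be a measurable weight with $w\ge A^{-1}$ on $B_R$ and $w(x)\le A(1+|x|/R)^{-(d+1)}$ everywhere, where $A\ge1$. *Wave packets.* For each $\theta$ choose a rectangular box of dimensions $KR^{-1/2}\times\dots\times KR^{-1/2}\times KR^{-1}$ containing $\theta$, where $K\ge1$. Let $T_\theta$ be the dual box centred at the origin (same axes, inverse side lengths), and tile $\mathbb R^d$ by the translates $T$ of (the half-open) $T_\theta$, one of them being $T_\theta$ itself. Fix a Schwartz function $\eta$ on $\mathbb R^d$ with $\hat\eta$ compactly supported, $\sum_{m\in\mathbb Z^d}\eta(\cdot-m)=1$, and $\eta\ne0$ on $[-\frac12,\frac12]^d$. Let $\psi_T$ be the composition of $\eta$ with the affine map taking $T$ to $[-\frac12,\frac12)^d$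 (translate $T$ to the origin, then rescale along the axes of the box). Put $g_{\theta,T}=\psi_Tg_\theta$, so that $\sum_Tg_{\theta,T}=g_\theta$. The magnitude of $g_{\theta,T}$ is $\sup_T|g_{\theta,T}|$. For $\lambda>0$ let $M_\lambda(x)$ be the number of pairs $(\theta,T)$ such that $T$ meets $B_R$, $x\in T$, and $g_{\theta,T}$ has magnitude at least $\lambda$. Let $M_\lambda=\sup_{x\in X}M_\lambda(x)$. Write $Y\sim Z$ for $C^{-1}Z\le Y\le CZ$. In each part below there is a constant $C\ge1$, depending only on the parameters named there, for which the assertions hold for all $0<\sigma<\frac12$ and $R>1$ (and for all grids, weights, boxes and $K$ as above). 1. ($C$ depends only on $d$.) $|g|\le CR^{(d-1)(\sigma-1)}$ everywhere, and $|g|\ge C^{-1}R^{(d-1)(\sigma-1)}$ at all points within distance $C^{-1}$ of $\Lambda\cap B_{R/C}$. Moreover $|X|\sim R^{d-(d+1)\sigma}$ and $$\|g\|_{L^p(X)}\sim R^{E}.$$ 2. ($C$ depends only on $d,A$.) For all $\theta$, $|g_\theta|\le CR^{-(d-1)}$ everywhere and $\|g_\theta\|_{L^p(w)}\le CR^{-(d-1)+d/p}$.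 If the grid is adapted, then for each $\theta$ with $g_\theta\not\equiv0$ one has $|g_\theta|\ge C^{-1}R^{-(d-1)}$ on $B_{R/C}$ and $\|g_\theta\|_{L^p(w)}\sim R^{-(d-1)+d/p}$. For every grid, $g$ is sharp for Bourgain–Demeter $\ell^2$ decoupling up to the $R^\varepsilon$-loss: $$\Big(\sum_\theta\|g_\theta\|_{L^p(w)}^2\Big)^{1/2}\sim R^{E},\qquad \Big(\sum_\theta\|g_\theta\|_{L^p(w)}^2\Big)^{1/2}\le C\|g\|_{L^p(B_R)}.$$ 3. ($C$ depends only on $d,A,\eta$.) All $g_{\theta,T}$ have magnitude at most $CR^{-(d-1)}$. If the grid is adapted, all $g_{\theta,T}$ with $g_\theta\not\equiv0$ and $T\cap B_{R/C}\neq\emptyset$ have magnitude at least $C^{-1}R^{-(d-1)}$. For all $0<\lambda\le C^{-1}R^{-(d-1)}$: $M_\lambda(y)\ge C^{-1}R^{(d-1)\sigma}$ for each $y\in\Lambda\cap B_{R/C}$; $M_\lambda\sim R^{(d-1)\sigma}$; and for every real $\varepsilon$ the right-hand side of the refined decoupling inequality satisfies $$R^\varepsilon M_\lambda^{\frac12-\frac1p}\Big(\sum_\theta\|g_\theta\|_{L^p(w)}^p\Big)^{1/p}\sim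 R^{E+\varepsilon},\qquad R^\varepsilon M_\lambda^{\frac12-\frac1p}\Big(\sum_\theta\|g_\theta\|_{L^p(w)}^p\Big)^{1/p}\le CR^\varepsilon\|g\|_{L^p(X)},$$ so that $g$ is sharp for refined decoupling up to the $R^\varepsilon$-loss. 4. If $R\ge16$, an adapted grid exists. -/

import Mathlib

open MeasureTheory Set
open scoped ENNReal NNReal SchwartzMap FourierTransform

noncomputable section

namespace BBCRV

/-! Throughout, the ambient dimension is `d = n + 1`; a point of `ℝ^d` is written `(x', x_d)` with
`x' = (x_1, …, x_n)`, so that `d - 1 = n`, and `x_d` is the coordinate of index `Fin.last n`. -/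

/-- `ℝ^d` with its Euclidean norm and Lebesgue measure. -/
abbrev E (d : ℕ) : Type := EuclideanSpace ℝ (Fin d)

/-- The first `n` coordinates `x'` of a point of `ℝ^(n+1)`. -/
def horiz {n : ℕ} (x : E (n + 1)) : Fin n → ℝ := fun i => x i.castSucc

/-- The point `(ξ', |ξ'|²)` of the paraboloid above `ξ'`. -/
def paraLift {n : ℕ} (ξ : Fin n → ℝ) : E (n + 1) :=
  WithLp.toLp 2 (Fin.snoc (α := fun _ => ℝ) ξ (∑ i, ξ i ^ 2))

/-- The truncated paraboloid `P^(d-1)`. -/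
def paraboloid (n : ℕ) : Set (E (n + 1)) :=
  {ξ | ξ (Fin.last n) = ∑ i, horiz ξ i ^ 2 ∧ ∀ i, |horiz ξ i| ≤ 1}

/-- The hypersurface measure `dω` on `P^(d-1)`: the image under `ξ' ↦ (ξ', |ξ'|²)` of
`√(1 + 4|ξ'|²) dξ'` on the cube `[-1,1]^(d-1)`. -/
def surfaceMeasure (n : ℕ) : Measure (E (n + 1)) :=
  Measure.map paraLift
    ((volume.restrict (Icc (-1 : Fin n → ℝ) 1)).withDensity
      (fun ξ => ENNReal.ofReal (Real.sqrt (1 + 4 * ∑ i, ξ i ^ 2))))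

/-- The function `v` with `v̂ = f dω`, i.e. `v(x) = ∫ f(ξ) e^{2πi x·ξ} dω(ξ)`. -/
def ext {n : ℕ} (f : E (n + 1) → ℝ) (x : E (n + 1)) : ℂ :=
  ∫ ξ, Complex.exp (2 * Real.pi * Complex.I * (inner ℝ x ξ : ℝ)) * (f ξ : ℂ) ∂(surfaceMeasure n)

/-! ### The example -/

/-- The integer vectors `l` with `1 ≤ l_1, …, l_{d-1} < R^σ` (for integers, `l < R^σ` is the same
as `l < ⌈R^σ⌉`). -/
def freqs (n : ℕ) (σ R : ℝ) : Finset (Fin n → ℤ) :=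
  Fintype.piFinset fun _ => Finset.Ico (1 : ℤ) ⌈R ^ σ⌉

/-- The open box `∏ (l_i R^{-σ} - R^{-1}, l_i R^{-σ} + R^{-1})`. -/
def freqBox {n : ℕ} (σ R : ℝ) (l : Fin n → ℤ) : Set (Fin n → ℝ) :=
  {ξ | ∀ i, ξ i ∈ Ioo ((l i : ℝ) * R ^ (-σ) - R⁻¹) ((l i : ℝ) * R ^ (-σ) + R⁻¹)}

/-- The density `h`. -/
def hDensity (n : ℕ) (σ R : ℝ) (ξ : E (n + 1)) : ℝ :=
  ∑ l ∈ freqs n σ R, (freqBox σ R l).indicator (fun _ => (1 : ℝ)) (horiz ξ)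

/-- The Barceló–Bennett–Carbery–Ruiz–Vilela function `g`, with `ĝ = h dω`. -/
def g (n : ℕ) (σ R : ℝ) : E (n + 1) → ℂ := ext (hDensity n σ R)

/-- The points `(n_1 R^σ, …, n_{d-1} R^σ, n_d R^{2σ})`. -/
def lattice (n : ℕ) (σ R : ℝ) : Set (E (n + 1)) :=
  {x | ∃ m : Fin (n + 1) → ℤ,
    (∀ i : Fin n, x i.castSucc = (m i.castSucc : ℝ) * R ^ σ) ∧
      x (Fin.last n) = (m (Fin.last n) : ℝ) * R ^ (2 * σ)}

/-- The part in `B_R` of the `1`-neighbourhood of the lattice. -/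
def X (n : ℕ) (σ R : ℝ) : Set (E (n + 1)) :=
  Metric.thickening 1 (lattice n σ R) ∩ Metric.ball 0 R

/-- `p = 2(d+1)/(d-1)`. -/
def pCrit (n : ℕ) : ℝ := 2 * (((n + 1 : ℕ) : ℝ) + 1) / (((n + 1 : ℕ) : ℝ) - 1)

/-- `((d-1)/2) σ - (d-1)(d+2)/(2(d+1))`. -/
def sharpExp (n : ℕ) (σ : ℝ) : ℝ :=
  (((n + 1 : ℕ) : ℝ) - 1) / 2 * σ
    - (((n + 1 : ℕ) : ℝ) - 1) * (((n + 1 : ℕ) : ℝ) + 2) / (2 * (((n + 1 : ℕ) : ℝ) + 1))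

/-- `C⁻¹ B ≤ Y ≤ C B`. -/
def Comparable (C : ℝ) (Y : ℝ≥0∞) (B : ℝ) : Prop :=
  ENNReal.ofReal (C⁻¹ * B) ≤ Y ∧ Y ≤ ENNReal.ofReal (C * B)

/-! ### Caps, tubes and wave packets -/

/-- `s` is an admissible side length of the caps `θ` at scale `R`: it is `R^{-1/2}`, up to a factor
at most `2` that leaves room to fit the grid to `[-1,1]^(d-1)`. -/
def IsCapSide (R s : ℝ) : Prop := R ^ (-(1 / 2 : ℝ)) / 2 ≤ s ∧ s ≤ R ^ (-(1 / 2 : ℝ))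

/-- The cube of index `k` in the grid of `ℝ^(d-1)` with side `s` and corner `a`. -/
def gridCube {n : ℕ} (s : ℝ) (a : Fin n → ℝ) (k : Fin n → ℤ) : Set (Fin n → ℝ) :=
  {ξ | ∀ i, ξ i ∈ Ico (a i + s * k i) (a i + s * (k i + 1))}

/-- The cap `θ` of index `k`: the part of `P^(d-1)` above a grid cube. -/
def cap {n : ℕ} (s : ℝ) (a : Fin n → ℝ) (k : Fin n → ℤ) : Set (E (n + 1)) :=
  {ξ | ξ ∈ paraboloid n ∧ horiz ξ ∈ gridCube s a k}

/-- `v_θ` for `v̂ = f dω`: the part of `v` with frequencies in `θ`. -/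
def capPart {n : ℕ} (f : E (n + 1) → ℝ) (s : ℝ) (a : Fin n → ℝ) (k : Fin n → ℤ) :
    E (n + 1) → ℂ :=
  ext ((cap s a k).indicator f)

/-- The side lengths `K R^{-1/2}, …, K R^{-1/2}, K R^{-1}` of the boxes around the caps. -/
def boxWidth {n : ℕ} (R K : ℝ) (i : Fin (n + 1)) : ℝ :=
  if i = Fin.last n then K * R⁻¹ else K * R ^ (-(1 / 2 : ℝ))

/-- A choice, for each cap `θ`, of a rectangular box of dimensions
`K R^{-1/2} × ⋯ × K R^{-1/2} × K R^{-1}` that contains `θ`. -/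
structure CapBoxes (n : ℕ) (R K s : ℝ) (a : Fin n → ℝ) where
  /-- the directions of the sides -/
  basis : (Fin n → ℤ) → OrthonormalBasis (Fin (n + 1)) ℝ (E (n + 1))
  /-- the centre -/
  center : (Fin n → ℤ) → E (n + 1)
  cap_subset : ∀ k, ∀ ξ ∈ cap s a k, ∀ i,
    |inner ℝ (basis k i) (ξ - center k)| ≤ boxWidth R K i / 2

namespace CapBoxes

variable {n : ℕ} {R K s : ℝ} {a : Fin n → ℝ}

/-- Coordinates in which the dual box `T_θ` (centred at the origin, with side lengths the inverses
of those of the box of `θ`) is the cube `[-1/2, 1/2]^d`. -/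
def coord (𝔅 : CapBoxes n R K s a) (k : Fin n → ℤ) (x : E (n + 1)) : E (n + 1) :=
  WithLp.toLp 2 fun i => boxWidth R K i * inner ℝ (𝔅.basis k i) x

/-- The tile `T` of index `m` in the tiling of space by translates of `T_θ`. -/
def tube (𝔅 : CapBoxes n R K s a) (k : Fin n → ℤ) (m : Fin (n + 1) → ℤ) : Set (E (n + 1)) :=
  {x | ∀ i, 𝔅.coord k x i ∈ Ico ((m i : ℝ) - 1 / 2) ((m i : ℝ) + 1 / 2)}

end CapBoxes

/-- The integer vector `m` as a point of `ℝ^d`. -/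
def intVec {d : ℕ} (m : Fin d → ℤ) : E d := WithLp.toLp 2 fun i => (m i : ℝ)

/-- A profile for the smooth cutoffs of the wave packet decomposition: a Schwartz function with
compactly supported Fourier transform, whose integer translates sum to `1`, and which does not
vanish on the cube `[-1/2, 1/2]^d`. -/
structure Profile (d : ℕ) where
  /-- the function -/
  η : 𝓢(E d, ℂ)
  fourier_support : HasCompactSupport (𝓕 (η : E d → ℂ))
  sum_translates : ∀ y : E d, HasSum (fun m : Fin d → ℤ => η (y - intVec m)) 1
  ne_zero : ∀ y : E d, (∀ i, |y i| ≤ 1 / 2) → η y ≠ 0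

variable {n : ℕ} {R K s : ℝ} {a : Fin n → ℝ}

/-- The wave packet `v_{θ,T}`, namely `v_θ` times the cutoff adapted to `T`; thus
`∑_T v_{θ,T} = v_θ`. -/
def wavePacket (φ : Profile (n + 1)) (𝔅 : CapBoxes n R K s a) (f : E (n + 1) → ℝ)
    (k : Fin n → ℤ) (m : Fin (n + 1) → ℤ) (x : E (n + 1)) : ℂ :=
  φ.η (𝔅.coord k x - intVec m) * capPart f s a k x

/-- The magnitude of `v_{θ,T}`: the size of `|v_{θ,T}|` on `T`. -/
def magnitude (φ : Profile (n + 1)) (𝔅 : CapBoxes n R K s a) (f : E (n + 1) → ℝ)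
    (k : Fin n → ℤ) (m : Fin (n + 1) → ℤ) : ℝ≥0∞ :=
  ⨆ x ∈ 𝔅.tube k m, ‖wavePacket φ 𝔅 f k m x‖ₑ

/-- The wave packets in `B_R` of magnitude at least `lam` whose tube contains `x`. -/
def packetsAt (φ : Profile (n + 1)) (𝔅 : CapBoxes n R K s a) (f : E (n + 1) → ℝ)
    (lam : ℝ) (x : E (n + 1)) : Set ((Fin n → ℤ) × (Fin (n + 1) → ℤ)) :=
  {q | (𝔅.tube q.1 q.2 ∩ Metric.ball 0 R).Nonempty ∧ x ∈ 𝔅.tube q.1 q.2 ∧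
    ENNReal.ofReal lam ≤ magnitude φ 𝔅 f q.1 q.2}

/-- The least `M` such that each `x ∈ Y` hits at most `M` wave packets (of magnitude at least
`lam`). -/
def multiplicity (φ : Profile (n + 1)) (𝔅 : CapBoxes n R K s a) (f : E (n + 1) → ℝ)
    (lam : ℝ) (Y : Set (E (n + 1))) : ℝ≥0∞ :=
  ⨆ x ∈ Y, ((packetsAt φ 𝔅 f lam x).encard : ℝ≥0∞)

/-! ### The two sides of the decoupling inequalities -/

/-- `w` is a weight adapted to `B_R`: comparable to `1` on `B_R` and decaying away from it. -/
def IsBallWeight (n : ℕ) (A R : ℝ) (w : E (n + 1) → ℝ≥0∞) : Prop :=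
  Measurable w ∧ (∀ x ∈ Metric.ball (0 : E (n + 1)) R, ENNReal.ofReal A⁻¹ ≤ w x) ∧
    ∀ x, w x ≤ ENNReal.ofReal (A * (1 + ‖x‖ / R) ^ (-((n : ℝ) + 2)))

/-- `‖v‖_{L^p(Y)}` at the critical exponent `p`. -/
def lpOn (v : E (n + 1) → ℂ) (Y : Set (E (n + 1))) : ℝ≥0∞ :=
  eLpNorm v (ENNReal.ofReal (pCrit n)) (volume.restrict Y)

/-- `‖v_θ‖_{L^p(w)}` at the critical exponent `p`. -/
def capNorm (f : E (n + 1) → ℝ) (s : ℝ) (a : Fin n → ℝ) (w : E (n + 1) → ℝ≥0∞)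
    (k : Fin n → ℤ) : ℝ≥0∞ :=
  eLpNorm (capPart f s a k) (ENNReal.ofReal (pCrit n)) (volume.withDensity w)

/-- `(∑_θ ‖v_θ‖_{L^p(w)}^q)^{1/q}`. -/
def capSum (f : E (n + 1) → ℝ) (s : ℝ) (a : Fin n → ℝ) (w : E (n + 1) → ℝ≥0∞) (q : ℝ) : ℝ≥0∞ :=
  (∑' k : Fin n → ℤ, capNorm f s a w k ^ q) ^ (1 / q)

/-- The right-hand side `R^ε M^{1/2 - 1/p} (∑_θ ‖v_θ‖_{L^p(w)}^p)^{1/p}` of the refined decoupling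
inequality on `Y`. -/
def refinedRHS (φ : Profile (n + 1)) (𝔅 : CapBoxes n R K s a) (f : E (n + 1) → ℝ)
    (lam : ℝ) (Y : Set (E (n + 1))) (w : E (n + 1) → ℝ≥0∞) (ε : ℝ) : ℝ≥0∞ :=
  ENNReal.ofReal (R ^ ε) * multiplicity φ 𝔅 f lam Y ^ (1 / 2 - 1 / pCrit n)
    * capSum f s a w (pCrit n)

/-- The grid of caps is adapted to `g`: no frequency box of `g` is divided between caps. -/
def IsAdapted (n : ℕ) (σ R s : ℝ) (a : Fin n → ℝ) : Prop :=
  ∀ l ∈ freqs n σ R, ∃ k, freqBox σ R l ∩ Icc (-1 : Fin n → ℝ) 1 ⊆ gridCube s a k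

end BBCRV

end

namespace BBCRV

/-! ### The surface measure -/

/-! Write `n = d - 1`. The density `h` is nonnegative, so every upper bound is the triangle
inequality `|ext f| ≤ ∫ f dω`, and every lower bound comes from an absence of cancellation. There
are about `R^{nσ}` boxes `Q_l`, each of measure about `R^{-n}`, hence `∫ h ~ R^{n(σ-1)}`.

Lower bound for `g`: the spacings of `Λ` are chosen so that `y · ξ` is an integer when `y ∈ Λ` and
`ξ` is the lifted centre of a box (`exists_int_inner_lattice`). The lifted boxes have diameter
`O(R⁻¹)`, so for `|y| ≤ cR` and `|x - y| ≤ c` all phases lie within `1/6` of an integer, their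
cosines are at least `1/2`, and `|g(x)| ≥ ½ ∫ h` (`half_integral_le_norm_ext_of_lattice`). Counting
lattice points gives `|X|`, and then `‖g‖_{L^p(X)}` is height times `|X|^{1/p}`.

Caps: since `s ≤ R^{-1/2} < R^{-σ}`, a cap meets `O(1)` boxes, so `|g_θ| ≲ R^{-n}`. Conversely each
`l` is assigned, injectively, a cap that contains a fixed fraction of `Q_l` (`capIndex`). For an
adapted grid such a cap holds a single box, whose phase is nearly constant on `B_{cR}`, and `|g_θ|`
is bounded below there. In a general grid a cap may cut several boxes, which can cancel pointwise.
There `g_θ` is tested against the modulated autocorrelation of a ball, whose Fourier transform is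
nonnegative: the other boxes can only help, and the mean of `|g_θ|` over `B_R` is `≳ R^{-n}`
(`lintegral_norm_ext_ge`). Hölder turns this into an `L^p` bound (`le_capNorm`). So about `R^{nσ}`
caps have norm about `R^{-n+d/p}`, and the critical `p` makes the `ℓ²` sum agree with
`‖g‖_{L^p(X)}`.

Wave packets: `|η| ~ 1` on the unit cube, so the magnitude on `T` is governed by `|g_θ|`. Each cap
has exactly one tile through a given point, so `M_λ` is at most the number of active caps; at a
lattice point all the caps assigned to boxes are large at once, for any grid. The factor
`M^{1/2-1/p}` then converts the `ℓ^p` sum into the `ℓ²` one. -/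

theorem norm_le_sum_abs {d : ℕ} (x : E d) : ‖x‖ ≤ ∑ i, |x i| := by
  rw [EuclideanSpace.norm_eq]
  refine Real.sqrt_le_iff.2 ⟨Finset.sum_nonneg fun i _ => abs_nonneg _, ?_⟩
  simpa using Finset.sum_sq_le_sq_sum_of_nonneg (s := Finset.univ) (f := fun i => |x i|)
    fun i _ => abs_nonneg _

@[simp]
theorem paraLift_castSucc {n : ℕ} (ξ : Fin n → ℝ) (i : Fin n) : paraLift ξ i.castSucc = ξ i := by
  simp [paraLift]

@[simp]
theorem paraLift_last {n : ℕ} (ξ : Fin n → ℝ) : paraLift ξ (Fin.last n) = ∑ i, ξ i ^ 2 := by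
  simp [paraLift]

@[simp]
theorem horiz_paraLift {n : ℕ} (ξ : Fin n → ℝ) : horiz (paraLift ξ) = ξ := by
  ext i; simp [horiz]

theorem measurable_paraLift {n : ℕ} : Measurable (paraLift (n := n)) := by
  refine (WithLp.measurable_toLp 2 _).comp (measurable_pi_lambda _ fun i => ?_)
  refine Fin.lastCases ?_ (fun i => ?_) i
  · simp only [Fin.snoc_last]; fun_prop
  · simp only [Fin.snoc_castSucc]; fun_prop

theorem measurable_horiz {n : ℕ} : Measurable (horiz (n := n)) := by
  unfold horiz; fun_prop

theorem measurableSet_paraboloid (n : ℕ) : MeasurableSet (paraboloid n) := by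
  have h := measurable_horiz (n := n)
  have h' : ∀ i, Measurable fun ξ : E (n + 1) => horiz ξ i := fun i => (measurable_pi_apply i).comp h
  refine MeasurableSet.inter (measurableSet_eq_fun (by fun_prop) (by fun_prop)) ?_
  exact measurableSet_setOfPred.2 (Measurable.forall fun i =>
    measurableSet_setOfPred.1 (measurableSet_le (h' i).abs measurable_const))

theorem paraLift_mem_paraboloid {n : ℕ} {ξ : Fin n → ℝ} (h : ξ ∈ Icc (-1 : Fin n → ℝ) 1) :
    paraLift ξ ∈ paraboloid n :=
  ⟨by simp, fun i => by simpa using abs_le.2 ⟨h.1 i, h.2 i⟩⟩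

theorem ae_mem_paraboloid (n : ℕ) : ∀ᵐ ξ ∂surfaceMeasure n, ξ ∈ paraboloid n := by
  refine (ae_map_iff (p := (· ∈ paraboloid n)) measurable_paraLift.aemeasurable
    (measurableSet_paraboloid n)).2 ?_
  refine (withDensity_absolutelyContinuous _ _).ae_le ?_
  filter_upwards [ae_restrict_mem measurableSet_Icc] with ξ hξ using paraLift_mem_paraboloid hξ

theorem surfaceMeasure_apply {n : ℕ} {S : Set (Fin n → ℝ)} (hS : MeasurableSet S) :
    surfaceMeasure n (horiz ⁻¹' S) = ∫⁻ ξ in S ∩ Icc (-1 : Fin n → ℝ) 1,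
      ENNReal.ofReal (Real.sqrt (1 + 4 * ∑ i, ξ i ^ 2)) := by
  have hp : paraLift ⁻¹' (horiz ⁻¹' S) = S := by ext ξ; simp
  rw [surfaceMeasure, Measure.map_apply measurable_paraLift (measurable_horiz hS), hp,
    withDensity_apply _ hS, Measure.restrict_restrict hS]

/-- The density `√(1 + 4|ξ'|²)` is at least `1`, and at most `1 + 4n` on the cube; this bound and
`surfaceMeasure_le` reduce every measure of frequencies to a Lebesgue measure. -/
theorem volume_le_surfaceMeasure {n : ℕ} {S : Set (Fin n → ℝ)} (hS : MeasurableSet S) :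
    volume (S ∩ Icc (-1 : Fin n → ℝ) 1) ≤ surfaceMeasure n (horiz ⁻¹' S) := by
  rw [surfaceMeasure_apply hS, ← setLIntegral_one]
  refine lintegral_mono fun ξ => ?_
  rw [← ENNReal.ofReal_one]
  refine ENNReal.ofReal_le_ofReal (Real.one_le_sqrt.2 ?_)
  have : 0 ≤ ∑ i, ξ i ^ 2 := Finset.sum_nonneg fun i _ => sq_nonneg _
  linarith

theorem surfaceMeasure_le {n : ℕ} {S : Set (Fin n → ℝ)} (hS : MeasurableSet S) :
    surfaceMeasure n (horiz ⁻¹' S) ≤ ENNReal.ofReal (1 + 4 * n) *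
      volume (S ∩ Icc (-1 : Fin n → ℝ) 1) := by
  rw [surfaceMeasure_apply hS, ← setLIntegral_const]
  refine setLIntegral_mono' (hS.inter measurableSet_Icc) fun ξ hξ => ENNReal.ofReal_le_ofReal ?_
  have h1 : ∑ i, ξ i ^ 2 ≤ n := by
    calc ∑ i, ξ i ^ 2 ≤ ∑ _i : Fin n, (1 : ℝ) := Finset.sum_le_sum fun i _ => by
          have h1 := hξ.2.1 i
          have h2 := hξ.2.2 i
          simp only [Pi.neg_apply, Pi.one_apply] at h1 h2
          nlinarith
      _ = n := by simp
  have h0 : 0 ≤ ∑ i, ξ i ^ 2 := Finset.sum_nonneg fun i _ => sq_nonneg _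
  refine Real.sqrt_le_iff.2 ⟨by positivity, ?_⟩
  nlinarith

instance (n : ℕ) : IsFiniteMeasure (surfaceMeasure n) := ⟨by
  have := surfaceMeasure_le (n := n) MeasurableSet.univ
  simp only [preimage_univ, univ_inter] at this
  exact this.trans_lt (ENNReal.mul_lt_top ENNReal.ofReal_lt_top isCompact_Icc.measure_lt_top)⟩

/-! ### The extension operator on nonnegative densities -/

/-- The character `e^{2πi x·ξ}`. -/
noncomputable def character {d : ℕ} (x ξ : E d) : ℂ :=
  Complex.exp (2 * Real.pi * Complex.I * (inner ℝ x ξ : ℝ))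

theorem character_eq {d : ℕ} (x ξ : E d) :
    character x ξ = Complex.exp ((2 * Real.pi * inner ℝ x ξ : ℝ) * Complex.I) := by
  unfold character; congr 1; push_cast; ring

theorem norm_character {d : ℕ} (x ξ : E d) : ‖character x ξ‖ = 1 := by
  rw [character_eq, Complex.norm_exp_ofReal_mul_I]

theorem continuous_character {d : ℕ} : Continuous fun q : E d × E d => character q.1 q.2 := by
  unfold character; fun_prop

theorem re_character {d : ℕ} (x ξ : E d) :
    (character x ξ).re = Real.cos (2 * Real.pi * inner ℝ x ξ) := by
  rw [character_eq, Complex.exp_ofReal_mul_I_re]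

/-- A phase within `1/6` of an integer is an angle of at most `π/3`. This fixes the tolerance `1/6`
used throughout. -/
theorem half_le_cos {t : ℝ} {z : ℤ} (h : |t - z| ≤ 1 / 6) : 1 / 2 ≤ Real.cos (2 * Real.pi * t) := by
  have h1 : Real.cos (2 * Real.pi * t) = Real.cos |2 * Real.pi * (t - z)| := by
    rw [Real.cos_abs, ← Real.cos_sub_int_mul_two_pi _ z]
    congr 1; ring
  rw [h1, ← Real.cos_pi_div_three, abs_mul, abs_of_pos Real.two_pi_pos]
  have := Real.pi_pos
  apply Real.cos_le_cos_of_nonneg_of_le_pi (by positivity) (by linarith)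
  nlinarith

theorem character_integrable {n : ℕ} {f : E (n + 1) → ℝ} (hf : Integrable f (surfaceMeasure n))
    (x : E (n + 1)) : Integrable (fun ξ => character x ξ * (f ξ : ℂ)) (surfaceMeasure n) := by
  refine hf.ofReal.bdd_mul (c := 1) ?_ (Filter.Eventually.of_forall fun ξ => (norm_character x ξ).le)
  exact (continuous_character.comp (Continuous.prodMk_right x)).aestronglyMeasurable

theorem norm_ext_le {n : ℕ} {f : E (n + 1) → ℝ} (h0 : ∀ ξ, 0 ≤ f ξ) (x : E (n + 1)) :
    ‖ext f x‖ ≤ ∫ ξ, f ξ ∂surfaceMeasure n := by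
  refine (norm_integral_le_integral_norm _).trans_eq (integral_congr_ae ?_)
  refine Filter.Eventually.of_forall fun ξ => ?_
  have := norm_character x ξ
  rw [character] at this
  simp only [norm_mul, this, one_mul, Complex.norm_real, Real.norm_eq_abs, abs_of_nonneg (h0 ξ)]

theorem continuous_ext {n : ℕ} {f : E (n + 1) → ℝ} (hf : Integrable f (surfaceMeasure n)) :
    Continuous (ext f) := by
  refine continuous_of_dominated (bound := fun ξ => ‖f ξ‖)
    (fun x => (character_integrable hf x).aestronglyMeasurable) (fun x => ?_) hf.norm ?_
  · refine Filter.Eventually.of_forall fun ξ => ?_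
    have := norm_character x ξ
    rw [character] at this
    simp [this]
  · refine Filter.Eventually.of_forall fun ξ => ?_
    have := continuous_character.comp (Continuous.prodMk_left ξ)
    exact this.mul continuous_const

/-- If the phases are nearly aligned at `x` then there is no cancellation. -/
theorem half_integral_le_norm_ext {n : ℕ} {f : E (n + 1) → ℝ} (h0 : ∀ ξ, 0 ≤ f ξ)
    (hf : Integrable f (surfaceMeasure n)) (x : E (n + 1)) (t : ℝ)
    (hx : ∀ ξ ∈ paraboloid n, f ξ ≠ 0 → ∃ z : ℤ, |inner ℝ x ξ - t - z| ≤ 1 / 6) :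
    (1 / 2) * ∫ ξ, f ξ ∂surfaceMeasure n ≤ ‖ext f x‖ := by
  -- The unimodular factor `c` removes the common phase `t`, so that the real part of the rotated
  -- integrand is at least half the density.
  set c : ℂ := Complex.exp ((-(2 * Real.pi * t) : ℝ) * Complex.I) with hc
  have hcn : ‖c‖ = 1 := Complex.norm_exp_ofReal_mul_I _
  have hI := (character_integrable hf x).const_mul c
  calc (1 / 2) * ∫ ξ, f ξ ∂surfaceMeasure n = ∫ ξ, (1 / 2) * f ξ ∂surfaceMeasure n := by
        rw [integral_const_mul]
    _ ≤ ∫ ξ, (c * (character x ξ * (f ξ : ℂ))).re ∂surfaceMeasure n := by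
        refine integral_mono_ae (hf.const_mul _) hI.re ?_
        filter_upwards [ae_mem_paraboloid n] with ξ hξ
        rw [← mul_assoc, Complex.re_mul_ofReal]
        by_cases hz : f ξ = 0
        · simp [hz]
        obtain ⟨z, hz⟩ := hx ξ hξ hz
        refine mul_le_mul_of_nonneg_right ?_ (h0 ξ)
        rw [hc, character_eq, ← Complex.exp_add, ← add_mul, ← Complex.ofReal_add,
          Complex.exp_ofReal_mul_I_re]
        have h := half_le_cos hz
        rwa [show 2 * Real.pi * (inner ℝ x ξ - t) = -(2 * Real.pi * t) + 2 * Real.pi * inner ℝ x ξ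
          by ring] at h
    _ = (∫ ξ, c * (character x ξ * (f ξ : ℂ)) ∂surfaceMeasure n).re := integral_re hI
    _ ≤ ‖∫ ξ, c * (character x ξ * (f ξ : ℂ)) ∂surfaceMeasure n‖ := Complex.re_le_norm _
    _ = ‖ext f x‖ := by
        rw [integral_const_mul, norm_mul, hcn, one_mul]; rfl

/-! ### A lower bound for the mean value of an extension -/

theorem character_mul {d : ℕ} (x ξ ζ : E d) :
    character x ξ * character x ζ = character x (ξ + ζ) := by
  simp only [character, ← Complex.exp_add, inner_add_right]
  congr 1; push_cast; ring

theorem character_sub_left {d : ℕ} (x y ξ : E d) :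
    character (x - y) ξ = character x ξ * (starRingEnd ℂ) (character y ξ) := by
  rw [character_eq, character_eq, character_eq, ← Complex.exp_conj, ← Complex.exp_add,
    inner_sub_left]
  congr 1
  simp only [map_mul, Complex.conj_ofReal, Complex.conj_I]
  push_cast; ring

/-- The Fourier transform of the indicator of a ball stays large at frequencies below the inverse
radius, since the phase `u · ζ` is then at most `1/6`. -/
theorem half_volume_le_norm_integral_character {d : ℕ} {r : ℝ} {ζ : E d}
    (h : r * ‖ζ‖ ≤ 1 / 6) :
    (1 / 2) * volume.real (Metric.ball (0 : E d) r) ≤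
      ‖∫ u in Metric.ball (0 : E d) r, character u ζ‖ := by
  have hcont : Continuous fun u : E d => character u ζ :=
    continuous_character.comp (Continuous.prodMk_left ζ)
  have hI : IntegrableOn (fun u : E d => character u ζ) (Metric.ball (0 : E d) r) :=
    Measure.integrableOn_of_bounded (M := 1) measure_ball_lt_top.ne hcont.aestronglyMeasurable
      (Filter.Eventually.of_forall fun u => (norm_character u ζ).le)
  calc (1 / 2) * volume.real (Metric.ball (0 : E d) r)
      = ∫ u in Metric.ball (0 : E d) r, (1 / 2 : ℝ) := by
        rw [setIntegral_const, smul_eq_mul, mul_comm]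
    _ ≤ ∫ u in Metric.ball (0 : E d) r, (character u ζ).re := by
        refine setIntegral_mono_on (integrableOn_const measure_ball_lt_top.ne) hI.re
          measurableSet_ball fun u hu => ?_
        rw [re_character]
        refine half_le_cos (z := 0) ?_
        rw [Int.cast_zero, sub_zero]
        refine (abs_real_inner_le_norm u ζ).trans (le_trans ?_ h)
        exact mul_le_mul_of_nonneg_right (mem_ball_zero_iff.1 hu).le (norm_nonneg _)
    _ = (∫ u in Metric.ball (0 : E d) r, character u ζ).re := integral_re hI
    _ ≤ _ := Complex.re_le_norm _

theorem integrable_character_sub_mul {n : ℕ} {f : E (n + 1) → ℝ}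
    (hf : Integrable f (surfaceMeasure n)) (ξ₀ : E (n + 1)) (B : Measure (E (n + 1) × E (n + 1)))
    [IsFiniteMeasure B] :
    Integrable (fun z : (E (n + 1) × E (n + 1)) × E (n + 1) =>
      character (z.1.1 - z.1.2) (z.2 - ξ₀) * (f z.2 : ℂ)) (B.prod (surfaceMeasure n)) := by
  have h1 : Integrable (fun z : (E (n + 1) × E (n + 1)) × E (n + 1) => ((f z.2 : ℝ) : ℂ))
      (B.prod (surfaceMeasure n)) := (hf.comp_snd B).ofReal
  have hc : Continuous fun z : (E (n + 1) × E (n + 1)) × E (n + 1) =>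
      character (z.1.1 - z.1.2) (z.2 - ξ₀) := by
    unfold character; fun_prop
  exact Integrable.bdd_mul h1 hc.aestronglyMeasurable
    (Filter.Eventually.of_forall fun z => (norm_character _ _).le)

/-- Testing `v` with `f dω = v̂` against a positive definite cutoff `B ∗ B̃`, modulated to the
frequency `ξ₀`: the part of `f` away from `ξ₀` contributes a nonnegative amount. -/
theorem integral_ext_sub {n : ℕ} {f : E (n + 1) → ℝ} (hf : Integrable f (surfaceMeasure n))
    (ξ₀ : E (n + 1)) (B : Measure (E (n + 1))) [IsFiniteMeasure B] :
    Integrable (fun ξ => ‖∫ u, character u (ξ - ξ₀) ∂B‖ ^ 2 * f ξ) (surfaceMeasure n) ∧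
    ∫ q : E (n + 1) × E (n + 1), character (q.1 - q.2) (-ξ₀) * ext f (q.1 - q.2) ∂(B.prod B) =
      ((∫ ξ, ‖∫ u, character u (ξ - ξ₀) ∂B‖ ^ 2 * f ξ ∂surfaceMeasure n : ℝ) : ℂ) := by
  have hint := integrable_character_sub_mul hf ξ₀ (B.prod B)
  have hinner : ∀ ξ, ∫ q : E (n + 1) × E (n + 1),
      character (q.1 - q.2) (ξ - ξ₀) * (f ξ : ℂ) ∂(B.prod B) =
      ((‖∫ u, character u (ξ - ξ₀) ∂B‖ ^ 2 * f ξ : ℝ) : ℂ) := by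
    intro ξ
    rw [integral_mul_const]
    simp only [character_sub_left]
    rw [integral_prod_mul (μ := B) (ν := B) (fun u => character u (ξ - ξ₀))
      (fun v => (starRingEnd ℂ) (character v (ξ - ξ₀))), integral_conj, Complex.mul_conj,
      Complex.normSq_eq_norm_sq]
    push_cast; ring
  have hright := hint.integral_prod_right
  simp only [hinner] at hright
  refine ⟨?_, ?_⟩
  · refine hright.re.congr (Filter.Eventually.of_forall fun ξ => ?_)
    exact Complex.ofReal_re _
  calc _ = ∫ q : E (n + 1) × E (n + 1), ∫ ξ, character (q.1 - q.2) (ξ - ξ₀) * (f ξ : ℂ)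
          ∂surfaceMeasure n ∂(B.prod B) := by
        refine integral_congr_ae (Filter.Eventually.of_forall fun q => ?_)
        simp only
        rw [show ext f (q.1 - q.2) = ∫ ξ, character (q.1 - q.2) ξ * (f ξ : ℂ) ∂surfaceMeasure n
          from rfl, ← integral_const_mul]
        refine integral_congr_ae (Filter.Eventually.of_forall fun ξ => ?_)
        simp only
        rw [← mul_assoc, character_mul, neg_add_eq_sub]
    _ = ∫ ξ, ∫ q : E (n + 1) × E (n + 1), character (q.1 - q.2) (ξ - ξ₀) * (f ξ : ℂ)
          ∂(B.prod B) ∂surfaceMeasure n := integral_integral_swap hint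
    _ = _ := by
        simp only [hinner]
        exact integral_ofReal

/-- Serves when `f` also has mass far from `ξ₀`, where a pointwise bound could fail through
cancellation. In `integral_ext_sub` that mass enters with the weight `|∫_B character|² ≥ 0` and is
dropped; on `S` the weight is at least `|B|²/4`. One factor `|B|` is cancelled against the outer
integral, because for `u ∈ B_r` the points `u - v` with `v ∈ B_r` stay in `B_{2r}`. -/
theorem lintegral_norm_ext_ge {n : ℕ} {f : E (n + 1) → ℝ} (h0 : ∀ ξ, 0 ≤ f ξ)
    (hf : Integrable f (surfaceMeasure n)) (ξ₀ : E (n + 1)) {r : ℝ} (hr : 0 < r)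
    {S : Set (E (n + 1))} (hS : MeasurableSet S) (hfS : ∀ ξ ∈ S, ξ ∈ paraboloid n → 1 ≤ f ξ)
    (hSξ : ∀ ξ ∈ S, ξ ∈ paraboloid n → r * ‖ξ - ξ₀‖ ≤ 1 / 6) :
    ENNReal.ofReal (1 / 4) * surfaceMeasure n S * volume (Metric.ball (0 : E (n + 1)) r) ≤
      ∫⁻ x in Metric.ball (0 : E (n + 1)) (2 * r), ‖ext f x‖ₑ := by
  set V := volume (Metric.ball (0 : E (n + 1)) r) with hV
  have hV0 : V ≠ 0 := (Metric.measure_ball_pos volume _ hr).ne'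
  have hVt : V ≠ ⊤ := measure_ball_lt_top.ne
  have : IsFiniteMeasure (volume.restrict (Metric.ball (0 : E (n + 1)) r)) :=
    ⟨by simpa using measure_ball_lt_top⟩
  obtain ⟨hint, heq⟩ := integral_ext_sub hf ξ₀ (volume.restrict (Metric.ball (0 : E (n + 1)) r))
  have hlow : (1 / 4) * V.toReal ^ 2 * (surfaceMeasure n).real S ≤
      ∫ ξ, ‖∫ u in Metric.ball (0 : E (n + 1)) r, character u (ξ - ξ₀)‖ ^ 2 * f ξ
        ∂surfaceMeasure n := by
    have : ∫ ξ, S.indicator (fun _ => (1 / 4) * V.toReal ^ 2) ξ ∂surfaceMeasure n =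
        (1 / 4) * V.toReal ^ 2 * (surfaceMeasure n).real S := by
      rw [integral_indicator_const _ hS, smul_eq_mul, mul_comm]
    rw [← this]
    refine integral_mono_ae ((integrable_const _).indicator hS) hint ?_
    filter_upwards [ae_mem_paraboloid n] with ξ hξ
    by_cases hmem : ξ ∈ S
    · rw [indicator_of_mem hmem]
      have h1 := half_volume_le_norm_integral_character (hSξ ξ hmem hξ)
      have h2 := hfS ξ hmem hξ
      have h3 : 0 ≤ V.toReal := ENNReal.toReal_nonneg
      change (1 / 2) * V.toReal ≤ _ at h1
      calc (1 / 4) * V.toReal ^ 2 = ((1 / 2) * V.toReal) ^ 2 * 1 := by ring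
        _ ≤ _ := by gcongr
    · rw [indicator_of_notMem hmem]
      exact mul_nonneg (by positivity) (h0 ξ)
  have hup : ENNReal.ofReal (∫ ξ, ‖∫ u in Metric.ball (0 : E (n + 1)) r, character u (ξ - ξ₀)‖ ^ 2
        * f ξ ∂surfaceMeasure n) ≤
      V * ∫⁻ x in Metric.ball (0 : E (n + 1)) (2 * r), ‖ext f x‖ₑ := by
    have hcont := continuous_ext hf
    calc _ = ‖((∫ ξ, ‖∫ u in Metric.ball (0 : E (n + 1)) r, character u (ξ - ξ₀)‖ ^ 2
        * f ξ ∂surfaceMeasure n : ℝ) : ℂ)‖ₑ := by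
          rw [← ofReal_norm, Complex.norm_real, Real.norm_of_nonneg]
          exact integral_nonneg fun ξ => mul_nonneg (by positivity) (h0 ξ)
      _ ≤ ∫⁻ q : E (n + 1) × E (n + 1), ‖ext f (q.1 - q.2)‖ₑ
          ∂((volume.restrict (Metric.ball 0 r)).prod (volume.restrict (Metric.ball 0 r))) := by
          rw [← heq]
          refine (enorm_integral_le_lintegral_enorm _).trans (lintegral_mono fun q => ?_)
          rw [enorm_mul, ← ofReal_norm (character _ _), norm_character]
          simp
      _ = ∫⁻ u in Metric.ball (0 : E (n + 1)) r, ∫⁻ v in Metric.ball (0 : E (n + 1)) r,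
            ‖ext f (u - v)‖ₑ := by
          refine lintegral_prod _ (Continuous.aemeasurable ?_)
          exact (hcont.comp (continuous_fst.sub continuous_snd)).enorm
      _ ≤ ∫⁻ u in Metric.ball (0 : E (n + 1)) r,
            ∫⁻ x in Metric.ball (0 : E (n + 1)) (2 * r), ‖ext f x‖ₑ := by
          refine setLIntegral_mono' measurableSet_ball fun u hu => ?_
          rw [← lintegral_indicator measurableSet_ball, ← lintegral_indicator measurableSet_ball,
            ← lintegral_sub_left_eq_self ((Metric.ball (0 : E (n + 1)) (2 * r)).indicator _) u]
          refine lintegral_mono fun v => ?_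
          by_cases hv : v ∈ Metric.ball (0 : E (n + 1)) r
          · rw [indicator_of_mem hv, indicator_of_mem]
            rw [mem_ball_zero_iff] at *
            exact (norm_sub_le u v).trans_lt (by linarith)
          · simp [indicator_of_notMem hv]
      _ = _ := by rw [setLIntegral_const, mul_comm]
  have h := (ENNReal.ofReal_le_ofReal hlow).trans hup
  rw [ENNReal.ofReal_mul (by positivity), ENNReal.ofReal_mul (by positivity),
    ENNReal.ofReal_pow ENNReal.toReal_nonneg, ENNReal.ofReal_toReal hVt, Measure.real,
    ENNReal.ofReal_toReal (measure_ne_top _ _)] at h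
  refine (ENNReal.mul_le_mul_iff_right hV0 hVt).1 (le_trans (le_of_eq ?_) h)
  ring

/-! ### Frequencies -/

section Frequencies

variable {n : ℕ} {σ R s : ℝ} {a : Fin n → ℝ}

theorem inv_lt_rpow_neg (hσ' : σ < 1 / 2) (hR : 1 < R) : R⁻¹ < R ^ (-σ) := by
  rw [← Real.rpow_neg_one]
  exact Real.rpow_lt_rpow_of_exponent_lt hR (by linarith)

theorem rpow_mul_rpow_neg (hR : 1 < R) : R ^ σ * R ^ (-σ) = 1 := by
  rw [← Real.rpow_add (by linarith)]; simp

theorem mem_freqs {l : Fin n → ℤ} : l ∈ freqs n σ R ↔ ∀ i, 1 ≤ l i ∧ (l i : ℝ) < R ^ σ := by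
  simp [freqs, Int.lt_ceil]

theorem card_freqs_le (hR : 1 < R) : ((freqs n σ R).card : ℝ) ≤ R ^ ((n : ℝ) * σ) := by
  have hpos : 0 < R ^ σ := Real.rpow_pos_of_pos (by linarith) _
  have h1 : (((Finset.Ico (1 : ℤ) ⌈R ^ σ⌉).card : ℕ) : ℝ) ≤ R ^ σ := by
    rw [Int.card_Ico, ← Int.cast_natCast,
      Int.toNat_of_nonneg (by have := Int.ceil_pos.2 hpos; omega)]
    push_cast
    linarith [Int.ceil_lt_add_one (R ^ σ)]
  rw [freqs, Fintype.card_piFinset_const, mul_comm, Real.rpow_mul (by linarith), Real.rpow_natCast]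
  push_cast
  gcongr

theorem le_card_freqs (hσ : 0 < σ) (hR : 1 < R) :
    (1 / 2) ^ n * R ^ ((n : ℝ) * σ) ≤ ((freqs n σ R).card : ℝ) := by
  have h1 : 1 < R ^ σ := Real.one_lt_rpow hR hσ
  have h2 : 1 / 2 * R ^ σ ≤ (((Finset.Ico (1 : ℤ) ⌈R ^ σ⌉).card : ℕ) : ℝ) := by
    -- Since `R^σ > 1` the ceiling is at least `2`, so removing one from it costs at most half of
    -- it, even for `R` near `1`.
    have h3 : (2 : ℤ) ≤ ⌈R ^ σ⌉ := by
      have : (1 : ℤ) < ⌈R ^ σ⌉ := Int.lt_ceil.2 (by exact_mod_cast h1)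
      omega
    have h4 : (2 : ℝ) ≤ (⌈R ^ σ⌉ : ℝ) := by exact_mod_cast h3
    rw [Int.card_Ico, ← Int.cast_natCast, Int.toNat_of_nonneg (by omega)]
    push_cast
    linarith [Int.le_ceil (R ^ σ)]
  rw [freqs, Fintype.card_piFinset_const, mul_comm (n : ℝ), Real.rpow_mul (by linarith),
    Real.rpow_natCast, ← mul_pow]
  push_cast
  gcongr

/-- Consequently `Q_l` can leave `[-1,1]^n` only on its upper sides; the half of `Q_l` below its
centre in every coordinate is always inside. -/
theorem freqs_mul_bounds (hσ' : σ < 1 / 2) (hR : 1 < R) {l : Fin n → ℤ} (hl : l ∈ freqs n σ R)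
    (i : Fin n) : R⁻¹ < (l i : ℝ) * R ^ (-σ) ∧ (l i : ℝ) * R ^ (-σ) < 1 := by
  obtain ⟨h1, h2⟩ := mem_freqs.1 hl i
  have h1' : (1 : ℝ) ≤ l i := by exact_mod_cast h1
  have hpos : 0 < R ^ (-σ) := Real.rpow_pos_of_pos (by linarith) _
  have := inv_lt_rpow_neg hσ' hR
  constructor
  · nlinarith
  · rw [← rpow_mul_rpow_neg (σ := σ) hR]
    gcongr

/-- The centre of the frequency box `Q_l`. -/
noncomputable def freqCenter (σ R : ℝ) (l : Fin n → ℤ) : Fin n → ℝ := fun i => (l i : ℝ) * R ^ (-σ)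

theorem norm_le_of_mem_paraboloid {ξ : E (n + 1)} (hξ : ξ ∈ paraboloid n) : ‖ξ‖ ≤ 2 * n := by
  refine (norm_le_sum_abs ξ).trans ?_
  rw [Fin.sum_univ_castSucc, hξ.1]
  have h1 : ∑ i : Fin n, |ξ i.castSucc| ≤ n := by
    calc _ ≤ ∑ _i : Fin n, (1 : ℝ) := Finset.sum_le_sum fun i _ => hξ.2 i
      _ = n := by simp
  have h2 : ∑ i : Fin n, horiz ξ i ^ 2 ≤ n := by
    calc _ ≤ ∑ _i : Fin n, (1 : ℝ) := Finset.sum_le_sum fun i _ => by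
          rw [← sq_abs]; exact pow_le_one₀ (abs_nonneg _) (hξ.2 i)
      _ = n := by simp
  rw [abs_of_nonneg (Finset.sum_nonneg fun i _ => sq_nonneg _)]
  linarith

/-- Since `|t² - c²| ≤ 2|t - c|` for `|t|, |c| ≤ 1`, lifting to the paraboloid keeps the diameter
`O(R⁻¹)`: the horizontal coordinates give `n R⁻¹`, the last one `2n R⁻¹`. At points of norm `cR` the
phase is therefore almost constant over the box. -/
theorem norm_sub_paraLift_le (hσ' : σ < 1 / 2) (hR : 1 < R) {l : Fin n → ℤ}
    (hl : l ∈ freqs n σ R) {ξ : E (n + 1)} (hξ : ξ ∈ paraboloid n)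
    (hb : horiz ξ ∈ freqBox σ R l) : ‖ξ - paraLift (freqCenter σ R l)‖ ≤ 3 * n * R⁻¹ := by
  have hR0 : 0 < R⁻¹ := by positivity
  have hd : ∀ i, |horiz ξ i - freqCenter σ R l i| ≤ R⁻¹ := fun i => by
    have := hb i
    rw [abs_le]; unfold freqCenter
    constructor <;> linarith [this.1, this.2]
  refine (norm_le_sum_abs _).trans ?_
  rw [Fin.sum_univ_castSucc]
  simp only [PiLp.sub_apply, paraLift_castSucc, paraLift_last]
  rw [hξ.1, ← Finset.sum_sub_distrib]
  have h1 : ∑ i : Fin n, |ξ i.castSucc - freqCenter σ R l i| ≤ n * R⁻¹ := by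
    calc _ ≤ ∑ _i : Fin n, R⁻¹ := Finset.sum_le_sum fun i _ => hd i
      _ = n * R⁻¹ := by simp
  have h2 : |∑ i : Fin n, (horiz ξ i ^ 2 - freqCenter σ R l i ^ 2)| ≤ 2 * n * R⁻¹ := by
    calc _ ≤ ∑ i : Fin n, |horiz ξ i ^ 2 - freqCenter σ R l i ^ 2| := Finset.abs_sum_le_sum_abs _ _
      _ ≤ ∑ _i : Fin n, 2 * R⁻¹ := Finset.sum_le_sum fun i _ => by
          rw [sq_sub_sq, abs_mul]
          have h3 := freqs_mul_bounds hσ' hR hl i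
          have h4 : |horiz ξ i + freqCenter σ R l i| ≤ 2 := by
            refine (abs_add_le _ _).trans ?_
            have : |freqCenter σ R l i| ≤ 1 := by
              unfold freqCenter; rw [abs_le]; constructor <;> linarith
            linarith [hξ.2 i]
          exact mul_le_mul h4 (hd i) (abs_nonneg _) (by norm_num)
      _ = 2 * n * R⁻¹ := by simp; ring
  linarith

/-- The spacings `R^σ` and `R^{2σ}` cancel the factors `R^{-σ}` in the centre and `R^{-2σ}` in its
square, which leaves an integer combination of integers. -/
theorem exists_int_inner_lattice (hR : 1 < R) {y : E (n + 1)} (hy : y ∈ lattice n σ R)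
    (l : Fin n → ℤ) : ∃ z : ℤ, inner ℝ y (paraLift (freqCenter σ R l)) = z := by
  obtain ⟨m, hm, hm'⟩ := hy
  refine ⟨∑ i : Fin n, m i.castSucc * l i + m (Fin.last n) * ∑ i, l i ^ 2, ?_⟩
  have h1 : R ^ (2 * σ) * (R ^ (-σ)) ^ 2 = 1 := by
    rw [mul_comm 2 σ, Real.rpow_mul (by linarith), Real.rpow_two, ← mul_pow,
      rpow_mul_rpow_neg hR, one_pow]
  rw [PiLp.inner_apply, Fin.sum_univ_castSucc]
  simp only [paraLift_castSucc, paraLift_last, hm, hm', freqCenter, RCLike.inner_apply,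
    conj_trivial]
  push_cast
  congr 1
  · refine Finset.sum_congr rfl fun i _ => ?_
    linear_combination (m i.castSucc * l i : ℝ) * rpow_mul_rpow_neg (σ := σ) hR
  · simp only [mul_pow, ← Finset.sum_mul]
    linear_combination (m (Fin.last n) * ∑ i, (l i : ℝ) ^ 2) * h1

/-! ### Surface measure of boxes of frequencies -/

theorem measurableSet_pi_Ioo (u v : Fin n → ℝ) :
    MeasurableSet {ξ : Fin n → ℝ | ∀ i, ξ i ∈ Ioo (u i) (v i)} := by
  have : {ξ : Fin n → ℝ | ∀ i, ξ i ∈ Ioo (u i) (v i)} = univ.pi fun i => Ioo (u i) (v i) := by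
    ext; simp
  rw [this]
  exact MeasurableSet.univ_pi fun i => measurableSet_Ioo

theorem measurableSet_freqBox (l : Fin n → ℤ) : MeasurableSet (freqBox σ R l) :=
  measurableSet_pi_Ioo _ _

theorem measurableSet_cap (k : Fin n → ℤ) : MeasurableSet (cap s a k) := by
  have : gridCube s a k = univ.pi fun i => Ico (a i + s * k i) (a i + s * (k i + 1)) := by
    ext; simp [gridCube]
  refine (measurableSet_paraboloid n).inter (measurable_horiz (?_ : MeasurableSet (gridCube s a k)))
  rw [this]
  exact MeasurableSet.univ_pi fun i => measurableSet_Ico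

theorem surfaceMeasure_freqBox_le (hR : 1 < R) (l : Fin n → ℤ) :
    (surfaceMeasure n).real (horiz ⁻¹' freqBox σ R l) ≤ (1 + 4 * n) * 2 ^ n * R ^ (-(n : ℝ)) := by
  have hR0 : 0 < R⁻¹ := by positivity
  have h1 : volume (freqBox σ R l) = ENNReal.ofReal ((2 * R⁻¹) ^ n) := by
    have : freqBox σ R l = univ.pi fun i => Ioo ((l i : ℝ) * R ^ (-σ) - R⁻¹)
        ((l i : ℝ) * R ^ (-σ) + R⁻¹) := by ext; simp [freqBox]
    rw [this, Real.volume_pi_Ioo, ENNReal.ofReal_pow (by positivity)]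
    simp only [add_sub_sub_cancel]
    rw [Finset.prod_const, Finset.card_univ, Fintype.card_fin]
    congr 2; ring
  have h2 := (surfaceMeasure_le (measurableSet_freqBox (σ := σ) (R := R) l)).trans
    (mul_le_mul_right (measure_mono inter_subset_left) _)
  rw [h1, ← ENNReal.ofReal_mul (by positivity)] at h2
  refine (ENNReal.toReal_le_of_le_ofReal (by positivity) h2).trans_eq ?_
  rw [Real.rpow_neg (by linarith), Real.rpow_natCast, mul_pow, inv_pow]; ring

theorem pow_le_surfaceMeasure {u : Fin n → ℝ} {δ : ℝ} (hδ : 0 ≤ δ) (hu : ∀ i, -1 ≤ u i)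
    (hu' : ∀ i, u i + δ ≤ 1) :
    δ ^ n ≤ (surfaceMeasure n).real (horiz ⁻¹' {ξ | ∀ i, ξ i ∈ Ioo (u i) (u i + δ)}) := by
  have h1 := volume_le_surfaceMeasure (measurableSet_pi_Ioo u fun i => u i + δ)
  have h2 : {ξ : Fin n → ℝ | ∀ i, ξ i ∈ Ioo (u i) (u i + δ)} ∩ Icc (-1 : Fin n → ℝ) 1 =
      univ.pi fun i => Ioo (u i) (u i + δ) := by
    ext ξ
    simp only [mem_inter_iff, mem_ofPred_eq, mem_univ_pi]
    refine ⟨fun h => h.1, fun h => ⟨h, fun i => ?_, fun i => ?_⟩⟩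
    · simpa using (hu i).trans (h i).1.le
    · simpa using (h i).2.le.trans (hu' i)
  rw [h2, Real.volume_pi_Ioo] at h1
  simp only [add_sub_cancel_left, Finset.prod_const, Finset.card_univ, Fintype.card_fin,
    ← ENNReal.ofReal_pow hδ] at h1
  exact (ENNReal.ofReal_le_iff_le_toReal (measure_ne_top _ _)).1 h1

/-! ### The density `h` and its total mass -/

theorem hDensity_nonneg (ξ : E (n + 1)) : 0 ≤ hDensity n σ R ξ :=
  Finset.sum_nonneg fun _ _ => indicator_nonneg (fun _ _ => zero_le_one) _

theorem hDensity_eq (ξ : E (n + 1)) : hDensity n σ R ξ =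
    ∑ l ∈ freqs n σ R, (horiz ⁻¹' freqBox σ R l).indicator (fun _ => (1 : ℝ)) ξ := rfl

theorem integrable_indicator_freqBox (l : Fin n → ℤ) :
    Integrable ((horiz ⁻¹' freqBox σ R l).indicator fun _ => (1 : ℝ)) (surfaceMeasure n) :=
  (integrable_const _).indicator (measurable_horiz (measurableSet_freqBox l))

theorem integral_indicator_freqBox (l : Fin n → ℤ) :
    ∫ ξ, (horiz ⁻¹' freqBox σ R l).indicator (fun _ => (1 : ℝ)) ξ ∂surfaceMeasure n =
      (surfaceMeasure n).real (horiz ⁻¹' freqBox σ R l) := by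
  rw [integral_indicator_const _ (measurable_horiz (measurableSet_freqBox l)), smul_eq_mul, mul_one]

theorem integrable_hDensity : Integrable (hDensity n σ R) (surfaceMeasure n) := by
  simp only [funext hDensity_eq]
  exact integrable_finsetSum _ fun l _ => integrable_indicator_freqBox l

theorem integral_hDensity : ∫ ξ, hDensity n σ R ξ ∂surfaceMeasure n =
    ∑ l ∈ freqs n σ R, (surfaceMeasure n).real (horiz ⁻¹' freqBox σ R l) := by
  simp only [hDensity_eq]
  rw [integral_finsetSum _ fun l _ => integrable_indicator_freqBox l]
  simp only [integral_indicator_freqBox]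

theorem exists_freq_of_hDensity_ne_zero {ξ : E (n + 1)} (h : hDensity n σ R ξ ≠ 0) :
    ∃ l ∈ freqs n σ R, horiz ξ ∈ freqBox σ R l := by
  obtain ⟨l, hl, h⟩ := Finset.exists_ne_zero_of_sum_ne_zero h
  exact ⟨l, hl, mem_of_indicator_ne_zero h⟩

theorem one_le_hDensity {l : Fin n → ℤ} (hl : l ∈ freqs n σ R) {ξ : E (n + 1)}
    (h : horiz ξ ∈ freqBox σ R l) : 1 ≤ hDensity n σ R ξ := by
  have h1 := Finset.single_le_sum (f := fun l => (freqBox σ R l).indicator (fun _ => (1 : ℝ))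
    (horiz ξ)) (fun l _ => indicator_nonneg (fun _ _ => zero_le_one) _) hl
  simpa [hDensity, indicator_of_mem h] using h1

theorem rpow_mul_sub_one (hR : 1 < R) :
    R ^ ((n : ℝ) * (σ - 1)) = R ^ ((n : ℝ) * σ) * R ^ (-(n : ℝ)) := by
  rw [← Real.rpow_add (by linarith)]; congr 1; ring

theorem integral_hDensity_le (hR : 1 < R) : ∫ ξ, hDensity n σ R ξ ∂surfaceMeasure n ≤
    (1 + 4 * n) * 2 ^ n * R ^ ((n : ℝ) * (σ - 1)) := by
  rw [integral_hDensity, rpow_mul_sub_one hR]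
  refine (Finset.sum_le_card_nsmul _ _ _ fun l _ => surfaceMeasure_freqBox_le hR l).trans ?_
  rw [nsmul_eq_mul]
  have h1 := card_freqs_le (n := n) (σ := σ) hR
  have h2 : 0 < R ^ (-(n : ℝ)) := Real.rpow_pos_of_pos (by linarith) _
  calc _ ≤ R ^ ((n : ℝ) * σ) * ((1 + 4 * n) * 2 ^ n * R ^ (-(n : ℝ))) := by gcongr
    _ = _ := by ring

theorem le_integral_hDensity (hσ : 0 < σ) (hσ' : σ < 1 / 2) (hR : 1 < R) :
    (1 / 2) ^ n * R ^ ((n : ℝ) * (σ - 1)) ≤ ∫ ξ, hDensity n σ R ξ ∂surfaceMeasure n := by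
  rw [integral_hDensity, rpow_mul_sub_one hR]
  have h2 : 0 < R ^ (-(n : ℝ)) := Real.rpow_pos_of_pos (by linarith) _
  have hR0 : 0 < R⁻¹ := by positivity
  refine le_trans ?_ (Finset.card_nsmul_le_sum _ _ (R ^ (-(n : ℝ))) fun l hl => ?_)
  · rw [nsmul_eq_mul, ← mul_assoc]
    exact mul_le_mul_of_nonneg_right (le_card_freqs hσ hR) h2.le
  -- Only the part of `Q_l` below its centre is used, a box of side `R⁻¹` that is certain to lie in
  -- the cube.
  · have hb := freqs_mul_bounds hσ' hR hl
    have h1 := pow_le_surfaceMeasure (u := fun i => (l i : ℝ) * R ^ (-σ) - R⁻¹) hR0.le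
      (fun i => by linarith [(hb i).1]) (fun i => by linarith [(hb i).2])
    rw [Real.rpow_neg (by linarith), Real.rpow_natCast, ← inv_pow]
    refine h1.trans (measureReal_mono (preimage_mono fun ξ hξ i => ?_))
    have := hξ i
    exact ⟨this.1, by linarith [this.2]⟩

/-- Near lattice points, all the frequencies of `g` are in phase. -/
theorem half_integral_le_norm_ext_of_lattice (hσ' : σ < 1 / 2) (hR : 1 < R)
    {f : E (n + 1) → ℝ} (h0 : ∀ ξ, 0 ≤ f ξ) (hf : Integrable f (surfaceMeasure n))
    (hfh : ∀ ξ, f ξ ≠ 0 → hDensity n σ R ξ ≠ 0) {y : E (n + 1)} (hy : y ∈ lattice n σ R)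
    (hyR : ‖y‖ ≤ (30 * (n + 1) : ℝ)⁻¹ * R) {x : E (n + 1)} (hx : dist x y ≤ (30 * (n + 1) : ℝ)⁻¹) :
    (1 / 2) * ∫ ξ, f ξ ∂surfaceMeasure n ≤ ‖ext f x‖ := by
  refine half_integral_le_norm_ext h0 hf x 0 fun ξ hξ hfξ => ?_
  obtain ⟨l, hl, hb⟩ := exists_freq_of_hDensity_ne_zero (hfh ξ hfξ)
  obtain ⟨z, hz⟩ := exists_int_inner_lattice hR hy l
  refine ⟨z, ?_⟩
  -- Two errors: moving from `y` to `x`, against `|ξ| ≤ 2n`, and moving from the centre to `ξ`, by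
  -- at most `3n R⁻¹`, against `|y|`. The constant `30(n + 1)` makes their sum at most `5n / (30(n +
  -- 1)) ≤ 1/6`.
  have h1 : inner ℝ x ξ - 0 - z = inner ℝ (x - y) ξ
      + inner ℝ y (ξ - paraLift (freqCenter σ R l)) := by
    rw [inner_sub_left, inner_sub_right, hz]; ring
  rw [h1]
  have h2 : |inner ℝ (x - y) ξ| ≤ (30 * (n + 1) : ℝ)⁻¹ * (2 * n) := by
    refine (abs_real_inner_le_norm _ _).trans ?_
    rw [← dist_eq_norm]
    have := norm_le_of_mem_paraboloid hξ
    gcongr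
  have h3 : |inner ℝ y (ξ - paraLift (freqCenter σ R l))| ≤ (30 * (n + 1) : ℝ)⁻¹ * (3 * n) := by
    refine (abs_real_inner_le_norm _ _).trans ?_
    calc _ ≤ (30 * (n + 1) : ℝ)⁻¹ * R * (3 * n * R⁻¹) := by
          have := norm_sub_paraLift_le hσ' hR hl hξ hb
          gcongr
      _ = _ := by field_simp
  have h4 : (30 * (n + 1) : ℝ)⁻¹ * (2 * n) + (30 * (n + 1) : ℝ)⁻¹ * (3 * n) ≤ 1 / 6 := by
    rw [← mul_add, inv_mul_le_iff₀ (by positivity)]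
    linarith
  exact (abs_add_le _ _).trans (by linarith)

end Frequencies

/-! ### Caps -/

section Caps

variable {n : ℕ} {σ R s : ℝ} {a : Fin n → ℝ}

theorem IsCapSide.lt_rpow_neg (hs : IsCapSide R s) (hσ' : σ < 1 / 2) (hR : 1 < R) :
    s < R ^ (-σ) :=
  hs.2.trans_lt (Real.rpow_lt_rpow_of_exponent_lt hR (by linarith))

theorem IsCapSide.inv_le (hs : IsCapSide R s) (hR : 1 < R) : R⁻¹ / 2 ≤ s := by
  refine le_trans ?_ hs.1
  rw [← Real.rpow_neg_one]
  have := Real.rpow_le_rpow_of_exponent_le hR.le (show (-1 : ℝ) ≤ -(1 / 2) by norm_num)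
  linarith

theorem IsCapSide.pos (hs : IsCapSide R s) (hR : 1 < R) : 0 < s :=
  lt_of_lt_of_le (by positivity) (hs.inv_le hR)

theorem mem_gridCube_iff (hs : 0 < s) {k : Fin n → ℤ} {ξ : Fin n → ℝ} :
    ξ ∈ gridCube s a k ↔ ∀ i, ⌊(ξ i - a i) / s⌋ = k i := by
  refine forall_congr' fun i => ?_
  rw [Int.floor_eq_iff, le_div_iff₀ hs, div_lt_iff₀ hs, mem_Ico]
  constructor <;> rintro ⟨h1, h2⟩ <;> constructor <;> linarith

theorem capDensity_nonneg (k : Fin n → ℤ) (ξ : E (n + 1)) :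
    0 ≤ (cap s a k).indicator (hDensity n σ R) ξ :=
  indicator_nonneg (fun ξ _ => hDensity_nonneg ξ) ξ

theorem integrable_capDensity (k : Fin n → ℤ) :
    Integrable ((cap s a k).indicator (hDensity n σ R)) (surfaceMeasure n) :=
  integrable_hDensity.indicator (measurableSet_cap k)

theorem exists_freq_of_capDensity_ne_zero {k : Fin n → ℤ} {ξ : E (n + 1)}
    (h : (cap s a k).indicator (hDensity n σ R) ξ ≠ 0) :
    ξ ∈ cap s a k ∧ ∃ l ∈ freqs n σ R, horiz ξ ∈ freqBox σ R l := by
  have hm := mem_of_indicator_ne_zero h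
  rw [indicator_of_mem hm] at h
  exact ⟨hm, exists_freq_of_hDensity_ne_zero h⟩

open Classical in
/-- The frequency boxes that meet a given cube of the grid. -/
noncomputable def freqsMeeting (σ R s : ℝ) (a : Fin n → ℝ) (k : Fin n → ℤ) : Finset (Fin n → ℤ) :=
  (freqs n σ R).filter fun l => (gridCube s a k ∩ freqBox σ R l).Nonempty

theorem mem_freqsMeeting {k l : Fin n → ℤ} : l ∈ freqsMeeting σ R s a k ↔
    l ∈ freqs n σ R ∧ (gridCube s a k ∩ freqBox σ R l).Nonempty := by
  classical exact Finset.mem_filter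

theorem card_piFinset_Icc (u : Fin n → ℤ) (m : ℕ) :
    (Fintype.piFinset fun i => Finset.Icc (u i) (u i + m)).card = (m + 1) ^ n := by
  have h : ∀ i, (Finset.Icc (u i) (u i + m)).card = m + 1 := fun i => by
    rw [Int.card_Icc]; omega
  simp only [Fintype.card_piFinset, h, Finset.prod_const, Finset.card_univ, Fintype.card_fin]

/-- Both the side `s` of the cube and the half-side `R⁻¹` of the boxes are below the spacing
`R^{-σ}` of the centres, which leaves three possible values for each coordinate of `l`. -/
theorem card_freqsMeeting_le (hσ' : σ < 1 / 2) (hR : 1 < R) (hs : IsCapSide R s)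
    (k : Fin n → ℤ) : (freqsMeeting σ R s a k).card ≤ 3 ^ n := by
  have hsub : freqsMeeting σ R s a k ⊆ Fintype.piFinset fun i =>
      Finset.Icc ⌊(a i + s * k i) * R ^ σ⌋ (⌊(a i + s * k i) * R ^ σ⌋ + 2) := by
    intro l hl
    obtain ⟨-, ξ, hξ, hb⟩ := mem_freqsMeeting.1 hl
    rw [Fintype.mem_piFinset]
    intro i
    have h1 := hξ i
    have h2 := hb i
    have h3 := hs.lt_rpow_neg hσ' hR
    have h4 := inv_lt_rpow_neg hσ' hR
    have hpos : 0 < R ^ σ := Real.rpow_pos_of_pos (by linarith) _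
    have h5 := rpow_mul_rpow_neg (σ := σ) hR
    have h6 : (l i : ℝ) = (l i * R ^ (-σ)) * R ^ σ := by linear_combination -(l i : ℝ) * h5
    have h7 : (a i + s * k i) * R ^ σ < l i + 1 := by
      have : (a i + s * k i) * R ^ σ < (l i * R ^ (-σ) + R ^ (-σ)) * R ^ σ := by
        exact mul_lt_mul_of_pos_right (by linarith [h1.1, h2.2]) hpos
      linarith
    have h8 : (l i : ℝ) < (a i + s * k i) * R ^ σ + 2 := by
      have : (l i * R ^ (-σ)) * R ^ σ < ((a i + s * k i) + 2 * R ^ (-σ)) * R ^ σ := by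
        exact mul_lt_mul_of_pos_right (by linarith [h1.2, h2.1]) hpos
      linarith
    rw [Finset.mem_Icc]
    constructor
    · have : (⌊(a i + s * k i) * R ^ σ⌋ : ℝ) < l i + 1 := (Int.floor_le _).trans_lt h7
      have : ⌊(a i + s * k i) * R ^ σ⌋ < l i + 1 := by exact_mod_cast this
      omega
    · have : (l i : ℝ) < ⌊(a i + s * k i) * R ^ σ⌋ + 3 := by
        linarith [Int.lt_floor_add_one ((a i + s * k i) * R ^ σ)]
      have : l i < ⌊(a i + s * k i) * R ^ σ⌋ + 3 := by exact_mod_cast this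
      omega
  exact (Finset.card_le_card hsub).trans_eq (card_piFinset_Icc _ 2)

theorem integral_capDensity_le (hσ' : σ < 1 / 2) (hR : 1 < R) (hs : IsCapSide R s)
    (k : Fin n → ℤ) : ∫ ξ, (cap s a k).indicator (hDensity n σ R) ξ ∂surfaceMeasure n ≤
      3 ^ n * ((1 + 4 * n) * 2 ^ n) * R ^ (-(n : ℝ)) := by
  have h2 : 0 < R ^ (-(n : ℝ)) := Real.rpow_pos_of_pos (by linarith) _
  calc _ ≤ ∫ ξ, ∑ l ∈ freqsMeeting σ R s a k,
        (horiz ⁻¹' freqBox σ R l).indicator (fun _ => (1 : ℝ)) ξ ∂surfaceMeasure n := by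
        refine integral_mono (integrable_capDensity k)
          (integrable_finsetSum _ fun l _ => integrable_indicator_freqBox l) fun ξ => ?_
        by_cases hξ : ξ ∈ cap s a k
        · simp only [indicator_of_mem hξ, hDensity_eq]
          refine (Finset.sum_subset (fun l hl => (mem_freqsMeeting.1 hl).1) fun l hl hl' => ?_).ge
          refine indicator_of_notMem (fun hb => hl' ?_) _
          exact mem_freqsMeeting.2 ⟨hl, horiz ξ, hξ.2, hb⟩
        · simp only [indicator_of_notMem hξ]
          exact Finset.sum_nonneg fun l _ => indicator_nonneg (fun _ _ => zero_le_one) _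
    _ = ∑ l ∈ freqsMeeting σ R s a k, (surfaceMeasure n).real (horiz ⁻¹' freqBox σ R l) := by
        rw [integral_finsetSum _ fun l _ => integrable_indicator_freqBox l]
        simp only [integral_indicator_freqBox]
    _ ≤ (freqsMeeting σ R s a k).card • ((1 + 4 * n) * 2 ^ n * R ^ (-(n : ℝ))) :=
        Finset.sum_le_card_nsmul _ _ _ fun l _ => surfaceMeasure_freqBox_le hR l
    _ ≤ 3 ^ n * ((1 + 4 * n) * 2 ^ n * R ^ (-(n : ℝ))) := by
        rw [nsmul_eq_mul]
        have : ((freqsMeeting σ R s a k).card : ℝ) ≤ 3 ^ n := by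
          exact_mod_cast card_freqsMeeting_le hσ' hR hs k
        gcongr
    _ = _ := by ring

/-- The index of a cube of the grid that contains a large part of `Q_l ∩ [-1,1]^(d-1)`. -/
noncomputable def capIndex (σ R s : ℝ) (a : Fin n → ℝ) (l : Fin n → ℤ) : Fin n → ℤ :=
  fun i => ⌊((l i : ℝ) * R ^ (-σ) - R⁻¹ / 4 - a i) / s⌋

/-- The sampled points for different `l` differ by at least `R^{-σ} > s` in some coordinate, so no
cube contains two of them. -/
theorem capIndex_injective (hσ' : σ < 1 / 2) (hR : 1 < R) (hs : IsCapSide R s) :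
    Function.Injective (capIndex σ R s a) := by
  intro l l' h
  ext i
  have h1 : ⌊((l i : ℝ) * R ^ (-σ) - R⁻¹ / 4 - a i) / s⌋ =
    ⌊((l' i : ℝ) * R ^ (-σ) - R⁻¹ / 4 - a i) / s⌋ := congrFun h i
  have h2 := Int.abs_sub_lt_one_of_floor_eq_floor h1
  have hs0 := hs.pos hR
  have h3 := hs.lt_rpow_neg hσ' hR
  have hpos : 0 < R ^ (-σ) := hs0.trans h3
  rw [← sub_div, abs_div, abs_of_pos hs0, div_lt_one hs0] at h2
  have h4 : |(l i : ℝ) - l' i| * R ^ (-σ) < 1 * R ^ (-σ) := by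
    rw [one_mul, ← abs_of_pos hpos, ← abs_mul, abs_of_pos hpos]
    refine lt_of_eq_of_lt ?_ (h2.trans h3)
    congr 1; ring
  have h5 : |(l i : ℝ) - l' i| < 1 := lt_of_mul_lt_mul_right h4 hpos.le
  have h6 : |l i - l' i| < 1 := by exact_mod_cast h5
  rw [Int.abs_lt_one_iff] at h6
  omega

/-- In each coordinate, with `c` the centre of `Q_l`, the cube contains `c - R⁻¹/4` and has side at
least `R⁻¹/2`. Hence it contains the interval of length `R⁻¹/4` immediately to the left or
immediately to the right of that point; both lie below `c`, hence in `Q_l` and in `[-1,1]`. -/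
theorem exists_box_subset_gridCube (hσ' : σ < 1 / 2) (hR : 1 < R) (hs : IsCapSide R s)
    {l : Fin n → ℤ} (hl : l ∈ freqs n σ R) : ∃ u : Fin n → ℝ,
      (∀ i, -1 ≤ u i) ∧ (∀ i, u i + R⁻¹ / 4 ≤ 1) ∧
      ∀ ξ : Fin n → ℝ, (∀ i, ξ i ∈ Ioo (u i) (u i + R⁻¹ / 4)) →
        ξ ∈ gridCube s a (capIndex σ R s a l) ∧ ξ ∈ freqBox σ R l := by
  have hs0 := hs.pos hR
  have hR0 : 0 < R⁻¹ := by positivity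
  have key : ∀ i, ∃ u : ℝ, -1 ≤ u ∧ u + R⁻¹ / 4 ≤ 1 ∧ ∀ t ∈ Ioo u (u + R⁻¹ / 4),
      t ∈ Ico (a i + s * capIndex σ R s a l i) (a i + s * (capIndex σ R s a l i + 1)) ∧
      t ∈ Ioo ((l i : ℝ) * R ^ (-σ) - R⁻¹) ((l i : ℝ) * R ^ (-σ) + R⁻¹) := by
    intro i
    set c := (l i : ℝ) * R ^ (-σ) with hc
    have hb := freqs_mul_bounds hσ' hR hl i
    rw [← hc] at hb
    have h1 := Int.floor_le ((c - R⁻¹ / 4 - a i) / s)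
    have h2 := Int.lt_floor_add_one ((c - R⁻¹ / 4 - a i) / s)
    rw [le_div_iff₀ hs0] at h1
    rw [div_lt_iff₀ hs0] at h2
    change (capIndex σ R s a l i : ℝ) * s ≤ _ at h1
    change _ < ((capIndex σ R s a l i : ℝ) + 1) * s at h2
    have h3 := hs.inv_le hR
    generalize (capIndex σ R s a l i : ℝ) = K at *
    by_cases h4 : a i + s * K ≤ c - R⁻¹ / 4 - R⁻¹ / 4
    · refine ⟨c - R⁻¹ / 4 - R⁻¹ / 4, by linarith, by linarith, fun t ht => ?_⟩
      exact ⟨⟨by linarith [ht.1], by linarith [ht.2]⟩, by linarith [ht.1], by linarith [ht.2]⟩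
    · refine ⟨c - R⁻¹ / 4, by linarith, by linarith, fun t ht => ?_⟩
      exact ⟨⟨by linarith [ht.1], by linarith [ht.2]⟩, by linarith [ht.1], by linarith [ht.2]⟩
  choose u h1 h2 h3 using key
  exact ⟨u, h1, h2, fun ξ hξ => ⟨fun i => (h3 i _ (hξ i)).1, fun i => (h3 i _ (hξ i)).2⟩⟩

/-- A set of frequencies of size `R^{-(d-1)}` in `Q_l` and in the cap of index `capIndex l`. -/
theorem exists_subset_cap (hσ' : σ < 1 / 2) (hR : 1 < R) (hs : IsCapSide R s)
    {l : Fin n → ℤ} (hl : l ∈ freqs n σ R) : ∃ S : Set (E (n + 1)), MeasurableSet S ∧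
      (1 / 4) ^ n * R ^ (-(n : ℝ)) ≤ (surfaceMeasure n).real S ∧
      (∀ ξ ∈ S, horiz ξ ∈ freqBox σ R l) ∧
      ∀ ξ ∈ S, ξ ∈ paraboloid n →
        1 ≤ (cap s a (capIndex σ R s a l)).indicator (hDensity n σ R) ξ := by
  obtain ⟨u, h1, h2, h3⟩ := exists_box_subset_gridCube (a := a) hσ' hR hs hl
  refine ⟨_, measurable_horiz (measurableSet_pi_Ioo u fun i => u i + R⁻¹ / 4), ?_, fun ξ hξ => ?_,
    fun ξ hξ hp => ?_⟩
  · refine le_trans (le_of_eq ?_) (pow_le_surfaceMeasure (by positivity) h1 h2)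
    rw [Real.rpow_neg (by linarith), Real.rpow_natCast, ← inv_pow, ← mul_pow]
    congr 1; ring
  · exact (h3 _ hξ).2
  · have := h3 _ hξ
    rw [indicator_of_mem (show ξ ∈ cap s a (capIndex σ R s a l) from ⟨hp, this.1⟩)]
    exact one_le_hDensity hl this.2

theorem le_integral_capDensity (hσ' : σ < 1 / 2) (hR : 1 < R) (hs : IsCapSide R s)
    {l : Fin n → ℤ} (hl : l ∈ freqs n σ R) : (1 / 4) ^ n * R ^ (-(n : ℝ)) ≤
      ∫ ξ, (cap s a (capIndex σ R s a l)).indicator (hDensity n σ R) ξ ∂surfaceMeasure n := by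
  obtain ⟨S, hS, h1, -, h2⟩ := exists_subset_cap (a := a) hσ' hR hs hl
  refine h1.trans ?_
  rw [← integral_indicator_one hS]
  refine integral_mono_ae ((integrable_const _).indicator hS) (integrable_capDensity _) ?_
  filter_upwards [ae_mem_paraboloid n] with ξ hξ
  by_cases hm : ξ ∈ S
  · rw [indicator_of_mem hm]
    exact h2 ξ hm hξ
  · rw [indicator_of_notMem hm]
    exact capDensity_nonneg _ _

/-- A finite set of indices that contains those of all the caps in which `g` has frequencies. -/
noncomputable def activeCaps (σ R s : ℝ) (a : Fin n → ℝ) : Finset (Fin n → ℤ) :=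
  (freqs n σ R).biUnion fun l => Fintype.piFinset fun i =>
    Finset.Icc ⌊((l i : ℝ) * R ^ (-σ) - R⁻¹ - a i) / s⌋
      (⌊((l i : ℝ) * R ^ (-σ) - R⁻¹ - a i) / s⌋ + 4)

theorem card_activeCaps_le (hR : 1 < R) :
    ((activeCaps σ R s a).card : ℝ) ≤ 5 ^ n * R ^ ((n : ℝ) * σ) := by
  have h1 : (activeCaps σ R s a).card ≤ (freqs n σ R).card * 5 ^ n := by
    exact Finset.card_biUnion_le_card_mul _ _ _ fun l _ => (card_piFinset_Icc _ 4).le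
  calc ((activeCaps σ R s a).card : ℝ) ≤ (freqs n σ R).card * 5 ^ n := by exact_mod_cast h1
    _ ≤ R ^ ((n : ℝ) * σ) * 5 ^ n := by gcongr; exact card_freqs_le hR
    _ = _ := mul_comm _ _

theorem mem_activeCaps (hR : 1 < R) (hs : IsCapSide R s) {k : Fin n → ℤ} {ξ : E (n + 1)}
    (h : (cap s a k).indicator (hDensity n σ R) ξ ≠ 0) : k ∈ activeCaps σ R s a := by
  obtain ⟨⟨-, hk⟩, l, hl, hb⟩ := exists_freq_of_capDensity_ne_zero h
  have hs0 := hs.pos hR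
  rw [mem_gridCube_iff hs0] at hk
  refine Finset.mem_biUnion.2 ⟨l, hl, Fintype.mem_piFinset.2 fun i => ?_⟩
  rw [← hk i, Finset.mem_Icc]
  have h1 := hb i
  constructor
  · refine Int.floor_le_floor (div_le_div_of_nonneg_right ?_ hs0.le)
    linarith [h1.1]
  · rw [← Int.lt_add_one_iff, Int.floor_lt]
    -- The side `2R⁻¹` of `Q_l` is at most `4s`, hence at most five indices in each coordinate.
    have h2 : (horiz ξ i - a i) / s < ((l i : ℝ) * R ^ (-σ) - R⁻¹ - a i) / s + 4 := by
      rw [div_add' _ _ _ hs0.ne']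
      refine div_lt_div_of_pos_right ?_ hs0
      linarith [h1.2, hs.inv_le hR]
    push_cast
    linarith [Int.lt_floor_add_one (((l i : ℝ) * R ^ (-σ) - R⁻¹ - a i) / s)]

theorem capPart_eq_zero (hR : 1 < R) (hs : IsCapSide R s) {k : Fin n → ℤ}
    (hk : k ∉ activeCaps σ R s a) : capPart (hDensity n σ R) s a k = 0 := by
  have : (cap s a k).indicator (hDensity n σ R) = 0 := by
    ext ξ
    by_contra h
    exact hk (mem_activeCaps hR hs h)
  funext x
  simp [capPart, ext, this]

theorem norm_capPart_le (hσ' : σ < 1 / 2) (hR : 1 < R) (hs : IsCapSide R s) (k : Fin n → ℤ)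
    (x : E (n + 1)) : ‖capPart (hDensity n σ R) s a k x‖ ≤
      3 ^ n * ((1 + 4 * n) * 2 ^ n) * R ^ (-(n : ℝ)) :=
  (norm_ext_le (capDensity_nonneg k) x).trans (integral_capDensity_le hσ' hR hs k)

/-- At a lattice point all boxes are in phase, so a cap that cuts several of them shows no
cancellation either. This gives the multiplicity for grids that are not adapted. -/
theorem le_norm_capPart_of_lattice (hσ' : σ < 1 / 2) (hR : 1 < R) (hs : IsCapSide R s)
    {l : Fin n → ℤ} (hl : l ∈ freqs n σ R) {y : E (n + 1)} (hy : y ∈ lattice n σ R)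
    (hyR : ‖y‖ ≤ (30 * (n + 1) : ℝ)⁻¹ * R) : (1 / 2) * ((1 / 4) ^ n * R ^ (-(n : ℝ))) ≤
      ‖capPart (hDensity n σ R) s a (capIndex σ R s a l) y‖ := by
  refine le_trans ?_ (half_integral_le_norm_ext_of_lattice hσ' hR (capDensity_nonneg _)
    (integrable_capDensity _) (fun ξ h => ?_) hy hyR (x := y) (by rw [dist_self]; positivity))
  · gcongr; exact le_integral_capDensity hσ' hR hs hl
  · rwa [indicator_of_mem (mem_of_indicator_ne_zero h)] at h

/-- In an adapted grid each cap has the frequencies of at most one box. -/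
theorem IsAdapted.exists_unique_freq (had : IsAdapted n σ R s a) (hσ' : σ < 1 / 2) (hR : 1 < R)
    (hs : IsCapSide R s) {k : Fin n → ℤ} (hk : capPart (hDensity n σ R) s a k ≠ 0) :
    ∃ l ∈ freqs n σ R, capIndex σ R s a l = k ∧
      ∀ ξ, (cap s a k).indicator (hDensity n σ R) ξ ≠ 0 → horiz ξ ∈ freqBox σ R l := by
  have hs0 := hs.pos hR
  have hR0 : 0 < R⁻¹ := by positivity
  have hidx : ∀ l ∈ freqs n σ R, ∀ ξ, ξ ∈ cap s a k → horiz ξ ∈ freqBox σ R l →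
      capIndex σ R s a l = k := by
    intro l hl ξ hξ hb
    obtain ⟨k', hk'⟩ := had l hl
    have h1 := hk' ⟨hb, fun i => (abs_le.1 (hξ.1.2 i)).1, fun i => (abs_le.1 (hξ.1.2 i)).2⟩
    have hb' := freqs_mul_bounds hσ' hR hl
    -- The point sampled by `capIndex` lies in `Q_l ∩ [-1,1]^n`, so adaptedness puts it in the same
    -- cube as `ξ`.
    have h2 : (fun i => (l i : ℝ) * R ^ (-σ) - R⁻¹ / 4) ∈ gridCube s a k' := by
      refine hk' ⟨fun i => ⟨by linarith, by linarith⟩, fun i => ?_, fun i => ?_⟩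
      · simp only [Pi.neg_apply, Pi.one_apply]; linarith [(hb' i).1]
      · simp only [Pi.one_apply]; linarith [(hb' i).2]
    rw [mem_gridCube_iff hs0] at h1 h2
    have h3 := (mem_gridCube_iff hs0).1 hξ.2
    ext i
    rw [← h3 i, h1 i, ← h2 i, capIndex]
  obtain ⟨ξ, hξ⟩ : ∃ ξ, (cap s a k).indicator (hDensity n σ R) ξ ≠ 0 := by
    by_contra! h
    refine hk (funext fun x => ?_)
    simp [capPart, ext, h]
  obtain ⟨hξk, l, hl, hb⟩ := exists_freq_of_capDensity_ne_zero hξ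
  refine ⟨l, hl, hidx l hl ξ hξk hb, fun ζ hζ => ?_⟩
  obtain ⟨hζk, l', hl', hb'⟩ := exists_freq_of_capDensity_ne_zero hζ
  have := capIndex_injective hσ' hR hs ((hidx l hl ξ hξk hb).trans (hidx l' hl' ζ hζk hb').symm)
  rwa [this]

/-- With a single box in the cap, the phase of its centre factors out at every `x` in `B_{cR}`, and
the remaining phase is `O(|x| R⁻¹)`. No lattice is involved. -/
theorem IsAdapted.le_norm_capPart (had : IsAdapted n σ R s a) (hσ' : σ < 1 / 2) (hR : 1 < R)
    (hs : IsCapSide R s) {k : Fin n → ℤ} (hk : capPart (hDensity n σ R) s a k ≠ 0)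
    {x : E (n + 1)} (hx : ‖x‖ ≤ (30 * (n + 1) : ℝ)⁻¹ * R) :
    (1 / 2) * ((1 / 4) ^ n * R ^ (-(n : ℝ))) ≤ ‖capPart (hDensity n σ R) s a k x‖ := by
  obtain ⟨l, hl, rfl, h⟩ := had.exists_unique_freq hσ' hR hs hk
  refine le_trans ?_ (half_integral_le_norm_ext (capDensity_nonneg _) (integrable_capDensity _) x
    (inner ℝ x (paraLift (freqCenter σ R l))) fun ξ hξ hf => ⟨0, ?_⟩)
  · gcongr; exact le_integral_capDensity hσ' hR hs hl
  · rw [Int.cast_zero, sub_zero, ← inner_sub_right]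
    refine (abs_real_inner_le_norm _ _).trans ?_
    calc _ ≤ (30 * (n + 1) : ℝ)⁻¹ * R * (3 * n * R⁻¹) := by
          have := norm_sub_paraLift_le hσ' hR hl hξ (h ξ hf)
          gcongr
      _ = (30 * (n + 1) : ℝ)⁻¹ * (3 * n) := by field_simp
      _ ≤ 1 / 6 := by
          rw [inv_mul_le_iff₀ (by positivity)]
          linarith

/-- The grid whose cubes are centred at the points of `(R^{-σ}/M) ℤ^(d-1)`, with
`M = ⌈R^{1/2-σ}⌉`, is adapted. -/
theorem exists_isAdapted (hσ' : σ < 1 / 2) (hR : 16 ≤ R) :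
    ∃ (s : ℝ) (a : Fin n → ℝ), IsCapSide R s ∧ IsAdapted n σ R s a := by
  have hR1 : 1 < R := by linarith
  set b := R ^ (1 / 2 - σ) with hb
  have hb1 : 1 < b := Real.one_lt_rpow hR1 (by linarith)
  have hM0 : (0 : ℝ) < ⌈b⌉ := by linarith [Int.le_ceil b]
  have hpos : 0 < R ^ (-σ) := Real.rpow_pos_of_pos (by linarith) _
  have hhalf : R ^ (-(1 / 2 : ℝ)) * b = R ^ (-σ) := by
    rw [hb, ← Real.rpow_add (by linarith)]; congr 1; ring
  have hpos' : 0 < R ^ (-(1 / 2 : ℝ)) := Real.rpow_pos_of_pos (by linarith) _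
  have hside : IsCapSide R (R ^ (-σ) / ⌈b⌉) := by
    constructor
    · rw [le_div_iff₀ hM0, ← hhalf]
      nlinarith [Int.ceil_lt_add_one b]
    · rw [div_le_iff₀ hM0, ← hhalf]
      gcongr; exact Int.le_ceil b
  -- From `s ≥ R^{-1/2}/2` and `R^{-1/2} ≤ 1/4`, the half-side `R⁻¹` of `Q_l` is at most the
  -- half-side of the cube with the same centre. This is the role of `R ≥ 16`.
  have hinv : R⁻¹ ≤ R ^ (-σ) / ⌈b⌉ / 2 := by
    have h1 : R ^ (-(1 / 2 : ℝ)) ≤ 1 / 4 := by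
      calc R ^ (-(1 / 2 : ℝ)) ≤ (16 : ℝ) ^ (-(1 / 2 : ℝ)) :=
            Real.rpow_le_rpow_of_nonpos (by norm_num) hR (by norm_num)
        _ = 1 / 4 := by
            rw [show (16 : ℝ) = 4 ^ (2 : ℝ) by norm_num, ← Real.rpow_mul (by norm_num)]
            norm_num [Real.rpow_neg_one]
    have h2 : R⁻¹ = R ^ (-(1 / 2 : ℝ)) * R ^ (-(1 / 2 : ℝ)) := by
      rw [← Real.rpow_add (by linarith), ← Real.rpow_neg_one]; norm_num
    have h3 := hside.1
    nlinarith
  refine ⟨R ^ (-σ) / ⌈b⌉, fun _ => -(R ^ (-σ) / ⌈b⌉ / 2), hside, fun l _ => ⟨fun i => ⌈b⌉ * l i, ?_⟩⟩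
  rintro ξ ⟨hξ, -⟩ i
  have h1 := hξ i
  have h2 : R ^ (-σ) / ⌈b⌉ * ((⌈b⌉ * l i : ℤ) : ℝ) = l i * R ^ (-σ) := by
    push_cast; field_simp
  constructor
  · rw [h2]; linarith [h1.1]
  · rw [mul_add, h2]; linarith [h1.2]

end Caps

/-! ### Exponents and constants -/

theorem pCrit_eq (n : ℕ) : pCrit n = 2 * (n + 2) / n := by
  unfold pCrit; push_cast; congr 1 <;> ring

theorem two_lt_pCrit {n : ℕ} (hn : 1 ≤ n) : 2 < pCrit n := by
  have : (0 : ℝ) < n := by exact_mod_cast hn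
  rw [pCrit_eq, lt_div_iff₀ this]; linarith

theorem pCrit_inv {n : ℕ} : (pCrit n)⁻¹ = n / (2 * (n + 2)) := by
  rw [pCrit_eq, inv_div]

theorem toReal_pCrit {n : ℕ} (hn : 1 ≤ n) : (ENNReal.ofReal (pCrit n)).toReal = pCrit n :=
  ENNReal.toReal_ofReal (by linarith [two_lt_pCrit hn])

theorem ofReal_pCrit_ne_zero {n : ℕ} (hn : 1 ≤ n) : ENNReal.ofReal (pCrit n) ≠ 0 :=
  (ENNReal.ofReal_pos.2 (by linarith [two_lt_pCrit hn])).ne'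

theorem sharpExp_eq (n : ℕ) (σ : ℝ) :
    sharpExp n σ = n / 2 * σ - n * (n + 3) / (2 * (n + 2)) := by
  unfold sharpExp; push_cast; congr 1 <;> ring_nf

theorem Comparable.of_le {c C K B : ℝ} {Y : ℝ≥0∞} (hc : 0 < c) (hB : 0 ≤ B)
    (h1 : ENNReal.ofReal (c * B) ≤ Y) (h2 : Y ≤ ENNReal.ofReal (C * B)) (hK1 : c⁻¹ ≤ K)
    (hK2 : C ≤ K) : Comparable K Y B :=
  ⟨(ENNReal.ofReal_le_ofReal (mul_le_mul_of_nonneg_right (inv_le_of_inv_le₀ hc hK1) hB)).trans h1,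
    h2.trans (ENNReal.ofReal_le_ofReal (mul_le_mul_of_nonneg_right hK2 hB))⟩

/-! ### Lattice points -/

/-- The integer points of the box `∏ [-b_i, b_i]`. -/
noncomputable def intBox {d : ℕ} (b : Fin d → ℝ) : Finset (Fin d → ℤ) :=
  Fintype.piFinset fun i => Finset.Icc (-⌊b i⌋) ⌊b i⌋

theorem mem_intBox {d : ℕ} {b : Fin d → ℝ} {m : Fin d → ℤ} :
    m ∈ intBox b ↔ ∀ i, |(m i : ℝ)| ≤ b i := by
  rw [intBox, Fintype.mem_piFinset]
  refine forall_congr' fun i => ?_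
  rw [Finset.mem_Icc, ← abs_le, Int.le_floor, Int.cast_abs]

theorem card_intBox {d : ℕ} {b : Fin d → ℝ} (hb : ∀ i, 0 ≤ b i) :
    ((intBox b).card : ℝ) = ∏ i, (2 * (⌊b i⌋ : ℝ) + 1) := by
  rw [intBox, Fintype.card_piFinset, Nat.cast_prod]
  refine Finset.prod_congr rfl fun i _ => ?_
  have h := Int.floor_nonneg.2 (hb i)
  rw [Int.card_Icc, ← Int.cast_natCast, Int.toNat_of_nonneg (by omega)]
  push_cast; ring

/-- Valid also when some `b i < 1`, since `0` is always counted; hence no largeness of `R` is needed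
in the lower bound for `|X|`. -/
theorem prod_le_card_intBox {d : ℕ} {b : Fin d → ℝ} (hb : ∀ i, 0 ≤ b i) :
    ∏ i, b i ≤ ((intBox b).card : ℝ) := by
  rw [card_intBox hb]
  refine Finset.prod_le_prod (fun i _ => hb i) fun i _ => ?_
  have h : (0 : ℝ) ≤ ⌊b i⌋ := by exact_mod_cast Int.floor_nonneg.2 (hb i)
  linarith [Int.lt_floor_add_one (b i)]

theorem card_intBox_le {d : ℕ} {b : Fin d → ℝ} (hb : ∀ i, 0 ≤ b i) :
    ((intBox b).card : ℝ) ≤ ∏ i, (2 * b i + 1) := by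
  rw [card_intBox hb]
  refine Finset.prod_le_prod (fun i _ => ?_) fun i _ => ?_
  · have h : (0 : ℝ) ≤ ⌊b i⌋ := by exact_mod_cast Int.floor_nonneg.2 (hb i)
    linarith
  · linarith [Int.floor_le (b i)]

section Lattice

variable {n : ℕ} {σ R : ℝ}

/-- The spacing of the lattice in the coordinate directions. -/
noncomputable def latticeScale (n : ℕ) (σ R : ℝ) (i : Fin (n + 1)) : ℝ :=
  if i = Fin.last n then R ^ (2 * σ) else R ^ σ

theorem one_lt_latticeScale (hσ : 0 < σ) (hR : 1 < R) (i : Fin (n + 1)) :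
    1 < latticeScale n σ R i := by
  unfold latticeScale
  split_ifs <;> exact Real.one_lt_rpow hR (by linarith)

/-- As `2σ < 1`, the ratio of `R` to each spacing is at least `1`; the rounding in the count of
lattice points then costs only a constant. -/
theorem latticeScale_le (hσ : 0 < σ) (hσ' : σ < 1 / 2) (hR : 1 < R) (i : Fin (n + 1)) :
    latticeScale n σ R i ≤ R := by
  unfold latticeScale
  conv_rhs => rw [← Real.rpow_one R]
  split_ifs <;> exact Real.rpow_le_rpow_of_exponent_le hR.le (by linarith)

theorem prod_div_latticeScale (hR : 1 < R) (c : ℝ) :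
    ∏ i, c * (R / latticeScale n σ R i) =
      c ^ (n + 1) * R ^ (((n : ℝ) + 1) - ((n : ℝ) + 2) * σ) := by
  have hR0 : 0 < R := by linarith
  have h1 : ∏ i, latticeScale n σ R i = R ^ (((n : ℝ) + 2) * σ) := by
    rw [Fin.prod_univ_castSucc]
    simp only [latticeScale, Fin.castSucc_ne_last, if_false, if_true, Finset.prod_const,
      Finset.card_univ, Fintype.card_fin]
    rw [← Real.rpow_natCast, ← Real.rpow_mul hR0.le, ← Real.rpow_add hR0]
    congr 1; ring
  rw [Finset.prod_mul_distrib, Finset.prod_div_distrib, h1, Real.rpow_sub hR0]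
  simp only [Finset.prod_const, Finset.card_univ, Fintype.card_fin]
  rw [show ((n : ℝ) + 1) = ((n + 1 : ℕ) : ℝ) by push_cast; ring, Real.rpow_natCast]

/-- The lattice point with integer coordinates `m`. -/
noncomputable def latticePoint (σ R : ℝ) (m : Fin (n + 1) → ℤ) : E (n + 1) :=
  WithLp.toLp 2 fun i => (m i : ℝ) * latticeScale n σ R i

theorem latticePoint_mem (m : Fin (n + 1) → ℤ) : latticePoint σ R m ∈ lattice n σ R :=
  ⟨m, fun i => by simp [latticePoint, latticeScale], by simp [latticePoint, latticeScale]⟩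

theorem exists_latticePoint_eq {y : E (n + 1)} (hy : y ∈ lattice n σ R) :
    ∃ m, latticePoint σ R m = y := by
  obtain ⟨m, h1, h2⟩ := hy
  refine ⟨m, ?_⟩
  ext i
  refine Fin.lastCases ?_ (fun i => ?_) i
  · simp [latticePoint, latticeScale, h2]
  · simp [latticePoint, latticeScale, h1]

theorem zero_mem_lattice : (0 : E (n + 1)) ∈ lattice n σ R := ⟨0, by simp, by simp⟩

theorem X_subset (hσ : 0 < σ) (hR : 1 < R) :
    X n σ R ⊆ ⋃ m ∈ intBox fun i => 2 * (R / latticeScale n σ R i),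
      Metric.ball (latticePoint σ R m) 1 := by
  rintro x ⟨hx, hxR⟩
  obtain ⟨y, hy, hxy⟩ := Metric.mem_thickening_iff.1 hx
  obtain ⟨m, rfl⟩ := exists_latticePoint_eq hy
  refine mem_biUnion (mem_intBox.2 fun i => ?_) hxy
  have h0 := one_lt_latticeScale (n := n) hσ hR i
  have h1 : ‖latticePoint σ R m‖ ≤ 2 * R := by
    have h2 := norm_le_norm_add_norm_sub' (latticePoint σ R m) x
    rw [← dist_eq_norm, dist_comm] at h2
    linarith [mem_ball_zero_iff.1 hxR]
  have h3 := (PiLp.norm_apply_le (latticePoint σ R m) i).trans h1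
  simp only [latticePoint, Real.norm_eq_abs, abs_mul] at h3
  rw [abs_of_pos (by linarith : 0 < latticeScale n σ R i)] at h3
  rw [← mul_div_assoc, le_div_iff₀ (by linarith)]
  exact h3

theorem volume_X_le (n : ℕ) : ∃ C : ℝ, 0 < C ∧ ∀ σ R : ℝ, 0 < σ → σ < 1 / 2 → 1 < R →
    volume (X n σ R) ≤ ENNReal.ofReal (C * R ^ (((n : ℝ) + 1) - ((n : ℝ) + 2) * σ)) := by
  have hV : 0 < volume.real (Metric.ball (0 : E (n + 1)) 1) :=
    ENNReal.toReal_pos (Metric.measure_ball_pos _ _ one_pos).ne' measure_ball_lt_top.ne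
  refine ⟨5 ^ (n + 1) * volume.real (Metric.ball (0 : E (n + 1)) 1), by positivity,
    fun σ R hσ hσ' hR => ?_⟩
  set b : Fin (n + 1) → ℝ := fun i => 2 * (R / latticeScale n σ R i) with hb
  have h1 : ∀ i, 1 ≤ R / latticeScale n σ R i := fun i =>
    (one_le_div (by linarith [one_lt_latticeScale (n := n) hσ hR i])).2 (latticeScale_le hσ hσ' hR i)
  calc volume (X n σ R) ≤ ∑ m ∈ intBox b, volume (Metric.ball (latticePoint σ R m) 1) :=
        (measure_mono (X_subset hσ hR)).trans (measure_biUnion_finset_le _ _)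
    _ = ENNReal.ofReal ((intBox b).card * volume.real (Metric.ball (0 : E (n + 1)) 1)) := by
        simp only [Measure.addHaar_ball_center]
        rw [Finset.sum_const, nsmul_eq_mul, ENNReal.ofReal_mul (by positivity),
          ENNReal.ofReal_natCast, ofReal_measureReal measure_ball_lt_top.ne]
    _ ≤ _ := by
        refine ENNReal.ofReal_le_ofReal ?_
        -- With `t = R / latticeScale ≥ 1` each factor `2(2t) + 1` is at most `5t`.
        have h2 : ((intBox b).card : ℝ) ≤
            5 ^ (n + 1) * R ^ (((n : ℝ) + 1) - ((n : ℝ) + 2) * σ) := by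
          rw [← prod_div_latticeScale hR]
          refine (card_intBox_le fun i => by linarith [h1 i]).trans ?_
          exact Finset.prod_le_prod (fun i _ => by linarith [h1 i]) fun i _ => by linarith [h1 i]
        calc _ ≤ 5 ^ (n + 1) * R ^ (((n : ℝ) + 1) - ((n : ℝ) + 2) * σ) *
              volume.real (Metric.ball (0 : E (n + 1)) 1) := by gcongr
          _ = _ := by ring

/-- The radius, about the lattice points, on which the frequencies of `g` are in phase. -/
noncomputable def phaseRadius (n : ℕ) : ℝ := (30 * (n + 1) : ℝ)⁻¹

theorem phaseRadius_pos (n : ℕ) : 0 < phaseRadius n := by unfold phaseRadius; positivity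

theorem phaseRadius_le (n : ℕ) : phaseRadius n ≤ 1 / 30 := by
  unfold phaseRadius
  rw [one_div]
  refine inv_anti₀ (by norm_num) ?_
  have : (0 : ℝ) ≤ n := by positivity
  linarith

/-- A neighbourhood of the lattice points well inside `B_R`. -/
noncomputable def nearLattice (n : ℕ) (σ R : ℝ) : Set (E (n + 1)) :=
  ⋃ m ∈ intBox fun i => phaseRadius n / (n + 1) * (R / latticeScale n σ R i),
    Metric.ball (latticePoint σ R m) (phaseRadius n)

theorem measurableSet_nearLattice : MeasurableSet (nearLattice n σ R) :=
  Finset.measurableSet_biUnion _ fun _ _ => measurableSet_ball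

theorem norm_latticePoint_le (hσ : 0 < σ) (hR : 1 < R) {m : Fin (n + 1) → ℤ}
    (hm : m ∈ intBox fun i => phaseRadius n / (n + 1) * (R / latticeScale n σ R i)) :
    ‖latticePoint σ R m‖ ≤ phaseRadius n * R := by
  calc _ ≤ ∑ i, |latticePoint σ R m i| := norm_le_sum_abs _
    _ ≤ ∑ _i : Fin (n + 1), phaseRadius n / (n + 1) * R := by
        refine Finset.sum_le_sum fun i _ => ?_
        have h0 : 0 < latticeScale n σ R i := by linarith [one_lt_latticeScale (n := n) hσ hR i]
        have h1 := mem_intBox.1 hm i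
        rw [← mul_div_assoc, le_div_iff₀ h0] at h1
        simpa [latticePoint, abs_mul, abs_of_pos h0] using h1
    _ = _ := by
        simp only [Finset.sum_const, Finset.card_univ, Fintype.card_fin, nsmul_eq_mul]
        push_cast; field_simp

theorem exists_of_mem_nearLattice (hσ : 0 < σ) (hR : 1 < R) {x : E (n + 1)}
    (hx : x ∈ nearLattice n σ R) :
    ∃ y ∈ lattice n σ R, ‖y‖ ≤ phaseRadius n * R ∧ dist x y ≤ phaseRadius n := by
  obtain ⟨m, hm, hx⟩ := mem_iUnion₂.1 hx
  exact ⟨_, latticePoint_mem m, norm_latticePoint_le hσ hR hm, (Metric.mem_ball.1 hx).le⟩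

theorem nearLattice_subset_X (hσ : 0 < σ) (hR : 1 < R) : nearLattice n σ R ⊆ X n σ R := by
  intro x hx
  obtain ⟨y, hy, hyR, hxy⟩ := exists_of_mem_nearLattice hσ hR hx
  have := phaseRadius_le n
  refine ⟨Metric.mem_thickening_iff.2 ⟨y, hy, by linarith⟩, mem_ball_zero_iff.2 ?_⟩
  have h2 := norm_le_norm_add_norm_sub' x y
  rw [← dist_eq_norm] at h2
  nlinarith

theorem le_volume_nearLattice (n : ℕ) : ∃ c : ℝ, 0 < c ∧ ∀ σ R : ℝ, 0 < σ → 1 < R →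
    ENNReal.ofReal (c * R ^ (((n : ℝ) + 1) - ((n : ℝ) + 2) * σ)) ≤ volume (nearLattice n σ R) := by
  have hV : 0 < volume.real (Metric.ball (0 : E (n + 1)) (phaseRadius n)) :=
    ENNReal.toReal_pos (Metric.measure_ball_pos _ _ (phaseRadius_pos n)).ne' measure_ball_lt_top.ne
  have hr := phaseRadius_pos n
  refine ⟨(phaseRadius n / (n + 1)) ^ (n + 1) *
    volume.real (Metric.ball (0 : E (n + 1)) (phaseRadius n)), by positivity,
    fun σ R hσ hR => ?_⟩
  have h0 : ∀ i, 1 < latticeScale n σ R i := one_lt_latticeScale hσ hR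
  set b : Fin (n + 1) → ℝ := fun i => phaseRadius n / (n + 1) * (R / latticeScale n σ R i) with hb
  -- Distinct lattice points are more than `1` apart, and the radius is at most `1/30`.
  have hdisj : ((intBox b : Finset _) : Set (Fin (n + 1) → ℤ)).PairwiseDisjoint
      fun m => Metric.ball (latticePoint σ R m) (phaseRadius n) := by
    intro m _ m' _ hne
    refine Metric.ball_disjoint_ball ?_
    obtain ⟨i, hi⟩ := Function.ne_iff.1 hne
    have h1 : (1 : ℝ) ≤ |(m i : ℝ) - m' i| := by
      exact_mod_cast Int.one_le_abs (sub_ne_zero.2 hi)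
    have h2 := PiLp.norm_apply_le (latticePoint σ R m - latticePoint σ R m') i
    simp only [latticePoint, PiLp.sub_apply, ← sub_mul, Real.norm_eq_abs, abs_mul] at h2
    rw [abs_of_pos (by linarith [h0 i] : 0 < latticeScale n σ R i)] at h2
    rw [dist_eq_norm]
    change _ ≤ ‖latticePoint σ R m - latticePoint σ R m'‖ at h2
    have := phaseRadius_le n
    nlinarith [h0 i]
  rw [nearLattice, measure_biUnion_finset hdisj fun _ _ => measurableSet_ball]
  simp only [Measure.addHaar_ball_center]
  rw [Finset.sum_const, nsmul_eq_mul, ← ofReal_measureReal measure_ball_lt_top.ne,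
    ← ENNReal.ofReal_natCast, ← ENNReal.ofReal_mul (by positivity)]
  refine ENNReal.ofReal_le_ofReal ?_
  have h2 : (phaseRadius n / (n + 1)) ^ (n + 1) * R ^ (((n : ℝ) + 1) - ((n : ℝ) + 2) * σ) ≤
      ((intBox b).card : ℝ) := by
    rw [← prod_div_latticeScale hR]
    refine prod_le_card_intBox fun i => ?_
    have := h0 i
    positivity
  calc _ = (phaseRadius n / (n + 1)) ^ (n + 1) * R ^ (((n : ℝ) + 1) - ((n : ℝ) + 2) * σ) *
        volume.real (Metric.ball (0 : E (n + 1)) (phaseRadius n)) := by ring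
    _ ≤ _ := by gcongr

/-! ### The size of `g` -/

theorem norm_g_le (hR : 1 < R) (x : E (n + 1)) :
    ‖g n σ R x‖ ≤ (1 + 4 * n) * 2 ^ n * R ^ ((n : ℝ) * (σ - 1)) :=
  (norm_ext_le hDensity_nonneg x).trans (integral_hDensity_le hR)

theorem le_norm_g (hσ : 0 < σ) (hσ' : σ < 1 / 2) (hR : 1 < R) {y : E (n + 1)}
    (hy : y ∈ lattice n σ R) (hyR : ‖y‖ ≤ phaseRadius n * R) {x : E (n + 1)}
    (hx : dist x y ≤ phaseRadius n) :
    (1 / 2) ^ (n + 1) * R ^ ((n : ℝ) * (σ - 1)) ≤ ‖g n σ R x‖ := by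
  refine le_trans ?_ (half_integral_le_norm_ext_of_lattice hσ' hR hDensity_nonneg
    integrable_hDensity (fun _ h => h) hy hyR hx)
  have := le_integral_hDensity (n := n) hσ hσ' hR
  rw [pow_succ']
  linarith

/-- The height of `g` times `|X|^{1/p}`. -/
theorem rpow_sharpExp (hR : 1 < R) :
    R ^ ((n : ℝ) * (σ - 1)) * (R ^ (((n : ℝ) + 1) - ((n : ℝ) + 2) * σ)) ^ (pCrit n)⁻¹ =
      R ^ sharpExp n σ := by
  have hR0 : 0 < R := by linarith
  rw [← Real.rpow_mul hR0.le, ← Real.rpow_add hR0, sharpExp_eq, pCrit_inv]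
  congr 1
  field_simp; ring

theorem lpOn_g_le (hn : 1 ≤ n) : ∃ C : ℝ, 0 < C ∧ ∀ σ R : ℝ, 0 < σ → σ < 1 / 2 → 1 < R →
    lpOn (g n σ R) (X n σ R) ≤ ENNReal.ofReal (C * R ^ sharpExp n σ) := by
  obtain ⟨C, hC, h⟩ := volume_X_le n
  refine ⟨(1 + 4 * n) * 2 ^ n * C ^ (pCrit n)⁻¹, by positivity, fun σ R hσ hσ' hR => ?_⟩
  have hR0 : 0 < R := by linarith
  refine (eLpNorm_le_of_ae_bound (Filter.Eventually.of_forall (norm_g_le hR))).trans ?_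
  rw [Measure.restrict_apply_univ, toReal_pCrit hn]
  have hp : 0 ≤ (pCrit n)⁻¹ := inv_nonneg.2 (by linarith [two_lt_pCrit hn])
  refine (mul_le_mul_left (ENNReal.rpow_le_rpow (h σ R hσ hσ' hR) hp) _).trans_eq ?_
  rw [ENNReal.ofReal_rpow_of_nonneg (by positivity) hp, ← ENNReal.ofReal_mul (by positivity),
    Real.mul_rpow hC.le (by positivity), ← rpow_sharpExp hR]
  congr 1; ring

theorem le_lpOn_g (hn : 1 ≤ n) : ∃ c : ℝ, 0 < c ∧ ∀ σ R : ℝ, 0 < σ → σ < 1 / 2 → 1 < R →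
    ENNReal.ofReal (c * R ^ sharpExp n σ) ≤ lpOn (g n σ R) (X n σ R) := by
  obtain ⟨c, hc, h⟩ := le_volume_nearLattice n
  refine ⟨(1 / 2) ^ (n + 1) * c ^ (pCrit n)⁻¹, by positivity, fun σ R hσ hσ' hR => ?_⟩
  have hR0 : 0 < R := by linarith
  have hp : 0 ≤ (pCrit n)⁻¹ := inv_nonneg.2 (by linarith [two_lt_pCrit hn])
  have hb : 0 ≤ (1 / 2) ^ (n + 1) * R ^ ((n : ℝ) * (σ - 1)) := by positivity
  have h1 := le_eLpNorm_of_bddBelow (μ := volume.restrict (X n σ R)) (f := g n σ R)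
    (ofReal_pCrit_ne_zero hn) ENNReal.ofReal_ne_top
    (Real.toNNReal ((1 / 2) ^ (n + 1) * R ^ ((n : ℝ) * (σ - 1))))
    (measurableSet_nearLattice (n := n) (σ := σ) (R := R))
    (Filter.Eventually.of_forall fun x hx => by
      obtain ⟨y, hy, hyR, hxy⟩ := exists_of_mem_nearLattice hσ hR hx
      exact Real.toNNReal_le_iff_le_coe.2 (le_norm_g hσ hσ' hR hy hyR hxy))
  refine le_trans ?_ h1
  rw [Measure.restrict_apply measurableSet_nearLattice,
    inter_eq_left.2 (nearLattice_subset_X hσ hR), toReal_pCrit hn, one_div (pCrit n), ENNReal.smul_def,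
    smul_eq_mul]
  refine le_trans (le_of_eq ?_) (mul_le_mul_right (ENNReal.rpow_le_rpow (h σ R hσ hR) hp) _)
  change _ = ENNReal.ofReal _ * _
  rw [ENNReal.ofReal_rpow_of_nonneg (by positivity) hp, ← ENNReal.ofReal_mul hb,
    Real.mul_rpow hc.le (by positivity), ← rpow_sharpExp hR]
  congr 1; ring

end Lattice

/-! ### Norms of the parts of `g` -/

section CapNorm

variable {n : ℕ}

/-- The decay exponent `n + 2 = d + 1` exceeds the dimension, so the profile is integrable, and
rescaling by `R` yields the factor `R^d`. -/
theorem IsBallWeight.withDensity_univ_le (n : ℕ) : ∃ C : ℝ, 0 < C ∧ ∀ A R : ℝ, 1 ≤ A → 1 < R →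
    ∀ w : E (n + 1) → ℝ≥0∞, IsBallWeight n A R w →
      (volume.withDensity w) univ ≤ ENNReal.ofReal (A * C * R ^ ((n : ℝ) + 1)) := by
  set F : E (n + 1) → ℝ := fun y => (1 + ‖y‖) ^ (-((n : ℝ) + 2)) with hF
  have hFi : Integrable F := integrable_one_add_norm (by simp)
  have hF0 : ∀ y, 0 ≤ F y := fun y => by simp only [hF]; positivity
  have hI : 0 ≤ ∫ y, F y := integral_nonneg hF0
  refine ⟨(∫ y, F y) + 1, by linarith, fun A R hA hR w hw => ?_⟩
  have hR0 : 0 < R := by linarith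
  have hint : Integrable fun x => A * F (R⁻¹ • x) := (hFi.comp_smul (by positivity)).const_mul A
  calc (volume.withDensity w) univ = ∫⁻ x, w x := by
        rw [withDensity_apply _ MeasurableSet.univ, Measure.restrict_univ]
    _ ≤ ∫⁻ x, ENNReal.ofReal (A * F (R⁻¹ • x)) := lintegral_mono fun x => by
        refine (hw.2.2 x).trans_eq ?_
        simp only [hF, norm_smul, norm_inv, Real.norm_of_nonneg hR0.le, div_eq_inv_mul]
    _ = ENNReal.ofReal (∫ x, A * F (R⁻¹ • x)) :=
        (ofReal_integral_eq_lintegral_ofReal hint (Filter.Eventually.of_forall fun x =>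
          mul_nonneg (by linarith) (hF0 _))).symm
    _ = ENNReal.ofReal (A * (∫ y, F y) * R ^ ((n : ℝ) + 1)) := by
        rw [integral_const_mul, Measure.integral_comp_smul, finrank_euclideanSpace_fin, smul_eq_mul,
          inv_pow, inv_inv, abs_of_pos (by positivity), ← Real.rpow_natCast]
        push_cast; congr 1; ring
    _ ≤ _ := by
        refine ENNReal.ofReal_le_ofReal ?_
        have : 0 < R ^ ((n : ℝ) + 1) := by positivity
        gcongr
        linarith

theorem IsBallWeight.smul_restrict_le {A R : ℝ} {w : E (n + 1) → ℝ≥0∞}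
    (hw : IsBallWeight n A R w) :
    ENNReal.ofReal A⁻¹ • volume.restrict (Metric.ball (0 : E (n + 1)) R) ≤
      volume.withDensity w := by
  rw [← withDensity_const, ← withDensity_indicator measurableSet_ball]
  refine withDensity_mono (Filter.Eventually.of_forall fun x => ?_)
  by_cases hx : x ∈ Metric.ball (0 : E (n + 1)) R
  · simpa only [indicator_of_mem hx] using hw.2.1 x hx
  · simp only [indicator_of_notMem hx, zero_le]

theorem rpow_capExp {R : ℝ} (hR : 1 < R) : R ^ (-(n : ℝ) + ((n : ℝ) + 1) / pCrit n) =
    R ^ (-(n : ℝ)) * (R ^ ((n : ℝ) + 1)) ^ (pCrit n)⁻¹ := by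
  have hR0 : 0 < R := by linarith
  rw [← Real.rpow_mul hR0.le, ← Real.rpow_add hR0, div_eq_mul_inv]

theorem capNorm_le (hn : 1 ≤ n) (A : ℝ) (hA : 1 ≤ A) : ∃ C : ℝ, 0 < C ∧ ∀ σ R : ℝ,
    σ < 1 / 2 → 1 < R → ∀ (s : ℝ) (a : Fin n → ℝ), IsCapSide R s →
    ∀ w : E (n + 1) → ℝ≥0∞, IsBallWeight n A R w → ∀ k,
      capNorm (hDensity n σ R) s a w k ≤
        ENNReal.ofReal (C * R ^ (-(n : ℝ) + ((n : ℝ) + 1) / pCrit n)) := by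
  obtain ⟨C, hC, h⟩ := IsBallWeight.withDensity_univ_le n
  refine ⟨(A * C) ^ (pCrit n)⁻¹ * (3 ^ n * ((1 + 4 * n) * 2 ^ n)), by positivity,
    fun σ R hσ' hR s a hs w hw k => ?_⟩
  have hR0 : 0 < R := by linarith
  have hp : 0 ≤ (pCrit n)⁻¹ := inv_nonneg.2 (by linarith [two_lt_pCrit hn])
  refine (eLpNorm_le_of_ae_bound
    (Filter.Eventually.of_forall (norm_capPart_le hσ' hR hs k))).trans ?_
  rw [toReal_pCrit hn]
  refine (mul_le_mul_left (ENNReal.rpow_le_rpow (h A R hA hR w hw) hp) _).trans_eq ?_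
  rw [ENNReal.ofReal_rpow_of_nonneg (by positivity) hp, ← ENNReal.ofReal_mul (by positivity),
    Real.mul_rpow (by positivity) (by positivity), rpow_capExp hR]
  congr 1; ring

/-- The mean of `|g_θ|` over `B_R` is at least a multiple of `R^{-(d-1)}` for the caps `θ` that
contain a large part of a frequency box. -/
theorem le_lintegral_capPart (n : ℕ) : ∃ c : ℝ, 0 < c ∧ ∀ σ R : ℝ,
    σ < 1 / 2 → 1 < R → ∀ (s : ℝ) (a : Fin n → ℝ), IsCapSide R s → ∀ l ∈ freqs n σ R,
      ENNReal.ofReal (c * R ^ (-(n : ℝ))) * volume (Metric.ball (0 : E (n + 1)) R) ≤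
        ∫⁻ x in Metric.ball (0 : E (n + 1)) R,
          ‖capPart (hDensity n σ R) s a (capIndex σ R s a l) x‖ₑ := by
  refine ⟨1 / 4 * (1 / 4) ^ n * ((18 * ((n : ℝ) + 1))⁻¹) ^ (n + 1), by positivity,
    fun σ R hσ' hR s a hs l hl => ?_⟩
  have hR0 : 0 < R := by linarith
  obtain ⟨S, hS, h1, h2, h3⟩ := exists_subset_cap (a := a) hσ' hR hs hl
  -- Chosen so that over `B_{κR}` the phase varies by at most `κR · 3n R⁻¹ ≤ 1/6` on the lifted box,
  -- and so that `B_{2κR} ⊆ B_R`.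
  set κ := (18 * ((n : ℝ) + 1))⁻¹ with hκ
  have hκ0 : 0 < κ := by positivity
  have hκ1 : 2 * κ ≤ 1 := by
    rw [hκ, ← div_eq_mul_inv, div_le_one (by positivity)]
    have : (0 : ℝ) ≤ n := by positivity
    linarith
  have h4 := lintegral_norm_ext_ge (capDensity_nonneg _) (integrable_capDensity _)
    (paraLift (freqCenter σ R l)) (r := κ * R) (by positivity) hS h3 (fun ξ hξ hp => by
      calc κ * R * ‖ξ - paraLift (freqCenter σ R l)‖ ≤ κ * R * (3 * n * R⁻¹) := by
            have := norm_sub_paraLift_le hσ' hR hl hp (h2 ξ hξ)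
            gcongr
        _ = κ * (3 * n) := by field_simp
        _ ≤ 1 / 6 := by
            rw [hκ, inv_mul_le_iff₀ (by positivity)]
            linarith)
  have h5 : volume (Metric.ball (0 : E (n + 1)) (κ * R)) =
      ENNReal.ofReal (κ ^ (n + 1)) * volume (Metric.ball (0 : E (n + 1)) R) := by
    rw [Measure.addHaar_ball_mul _ _ hκ0.le, finrank_euclideanSpace_fin]
  calc _ = ENNReal.ofReal (1 / 4) * ENNReal.ofReal ((1 / 4) ^ n * R ^ (-(n : ℝ))) *
        volume (Metric.ball (0 : E (n + 1)) (κ * R)) := by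
        rw [h5, ← mul_assoc, ← ENNReal.ofReal_mul (by norm_num), ← ENNReal.ofReal_mul (by positivity)]
        congr 2; ring
    _ ≤ ENNReal.ofReal (1 / 4) * surfaceMeasure n S *
        volume (Metric.ball (0 : E (n + 1)) (κ * R)) := by
        gcongr
        exact (ENNReal.ofReal_le_iff_le_toReal (measure_ne_top _ _)).2 h1
    _ ≤ _ := h4.trans (lintegral_mono_set (Metric.ball_subset_ball (by nlinarith)))

theorem le_capNorm (hn : 1 ≤ n) (A : ℝ) (hA : 1 ≤ A) : ∃ c : ℝ, 0 < c ∧ ∀ σ R : ℝ,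
    σ < 1 / 2 → 1 < R → ∀ (s : ℝ) (a : Fin n → ℝ), IsCapSide R s →
    ∀ w : E (n + 1) → ℝ≥0∞, IsBallWeight n A R w → ∀ l ∈ freqs n σ R,
      ENNReal.ofReal (c * R ^ (-(n : ℝ) + ((n : ℝ) + 1) / pCrit n)) ≤
        capNorm (hDensity n σ R) s a w (capIndex σ R s a l) := by
  obtain ⟨c, hc, h⟩ := le_lintegral_capPart n
  have hV1 : 0 < volume.real (Metric.ball (0 : E (n + 1)) 1) :=
    ENNReal.toReal_pos (Metric.measure_ball_pos _ _ one_pos).ne' measure_ball_lt_top.ne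
  refine ⟨(A⁻¹) ^ (pCrit n)⁻¹ * c * volume.real (Metric.ball (0 : E (n + 1)) 1) ^ (pCrit n)⁻¹,
    by positivity, fun σ R hσ' hR s a hs w hw l hl => ?_⟩
  have hR0 : 0 < R := by linarith
  have hp2 := two_lt_pCrit hn
  have hp : 0 ≤ (pCrit n)⁻¹ := inv_nonneg.2 (by linarith)
  set F := capPart (hDensity n σ R) s a (capIndex σ R s a l) with hF
  set V := volume (Metric.ball (0 : E (n + 1)) R) with hV
  have hV0 : V ≠ 0 := (Metric.measure_ball_pos volume _ hR0).ne'
  have hVt : V ≠ ⊤ := measure_ball_lt_top.ne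
  set N := eLpNorm F (ENNReal.ofReal (pCrit n)) (volume.restrict (Metric.ball 0 R)) with hN
  have hcont : Continuous F := continuous_ext (integrable_capDensity _)
  -- Hölder on `B_R`: a lower bound for the mean of `|g_θ|` forces one for its `L^p` norm.
  have h1 : ENNReal.ofReal (c * R ^ (-(n : ℝ))) * V ≤ N * V ^ (1 - (pCrit n)⁻¹) := by
    refine (h σ R hσ' hR s a hs l hl).trans ?_
    rw [← eLpNorm_one_eq_lintegral_enorm]
    refine (eLpNorm_le_eLpNorm_mul_rpow_measure_univ (q := ENNReal.ofReal (pCrit n)) ?_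
      hcont.aestronglyMeasurable).trans_eq ?_
    · rw [← ENNReal.ofReal_one]; exact ENNReal.ofReal_le_ofReal (by linarith)
    · rw [toReal_pCrit hn, Measure.restrict_apply_univ]; simp [hV, hN]
  have h2 : ENNReal.ofReal (c * R ^ (-(n : ℝ))) * V ^ (pCrit n)⁻¹ ≤ N := by
    have hb0 : V ^ (1 - (pCrit n)⁻¹) ≠ 0 := by
      simp [ENNReal.rpow_eq_zero_iff, hV0, hVt]
    have hbt : V ^ (1 - (pCrit n)⁻¹) ≠ ⊤ := by
      simp [ENNReal.rpow_eq_top_iff, hV0, hVt]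
    refine (ENNReal.mul_le_mul_iff_left hb0 hbt).1 (le_trans (le_of_eq ?_) h1)
    rw [mul_assoc, ← ENNReal.rpow_add _ _ hV0 hVt, add_sub_cancel, ENNReal.rpow_one]
  have h3 : V = ENNReal.ofReal (R ^ ((n : ℝ) + 1) *
      volume.real (Metric.ball (0 : E (n + 1)) 1)) := by
    rw [hV, Measure.addHaar_ball _ _ hR0.le, finrank_euclideanSpace_fin,
      ENNReal.ofReal_mul (by positivity), ofReal_measureReal measure_ball_lt_top.ne,
      ← Real.rpow_natCast]
    push_cast; rfl
  have h4 : ENNReal.ofReal ((A⁻¹) ^ (pCrit n)⁻¹) * N ≤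
      capNorm (hDensity n σ R) s a w (capIndex σ R s a l) := by
    have h5 := eLpNorm_mono_measure (p := ENNReal.ofReal (pCrit n)) F hw.smul_restrict_le
    rw [eLpNorm_smul_measure_of_ne_zero (ENNReal.ofReal_pos.2 (by positivity)).ne', smul_eq_mul,
      one_div, ENNReal.toReal_inv, toReal_pCrit hn,
      ENNReal.ofReal_rpow_of_nonneg (by positivity) hp] at h5
    exact h5
  refine le_trans (le_of_eq ?_) ((mul_le_mul_right h2 _).trans h4)
  rw [h3, ENNReal.ofReal_rpow_of_nonneg (by positivity) hp, ← ENNReal.ofReal_mul (by positivity),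
    ← ENNReal.ofReal_mul (by positivity), Real.mul_rpow (by positivity) (by positivity),
    rpow_capExp hR]
  congr 1; ring

/-! ### Sums of the norms over the caps -/

theorem capSum_le (hn : 1 ≤ n) (A : ℝ) (hA : 1 ≤ A) : ∃ C : ℝ, 0 < C ∧ ∀ σ R : ℝ,
    σ < 1 / 2 → 1 < R → ∀ (s : ℝ) (a : Fin n → ℝ), IsCapSide R s →
    ∀ w : E (n + 1) → ℝ≥0∞, IsBallWeight n A R w → ∀ q : ℝ, 1 ≤ q →
      capSum (hDensity n σ R) s a w q ≤ ENNReal.ofReal (C *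
        ((R ^ ((n : ℝ) * σ)) ^ (1 / q) * R ^ (-(n : ℝ) + ((n : ℝ) + 1) / pCrit n))) := by
  obtain ⟨C, hC, h⟩ := capNorm_le hn A hA
  refine ⟨5 ^ n * C, by positivity, fun σ R hσ' hR s a hs w hw q hq => ?_⟩
  have hR0 : 0 < R := by linarith
  have hq0 : 0 < q := by linarith
  set B := R ^ (-(n : ℝ) + ((n : ℝ) + 1) / pCrit n) with hB
  have hB0 : 0 < B := by positivity
  have h1 : ∑' k, capNorm (hDensity n σ R) s a w k ^ q ≤
      ENNReal.ofReal (5 ^ n * R ^ ((n : ℝ) * σ) * (C * B) ^ q) := by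
    rw [tsum_eq_sum (s := activeCaps σ R s a) fun k hk => by
      rw [capNorm, capPart_eq_zero hR hs hk, eLpNorm_zero, ENNReal.zero_rpow_of_pos hq0]]
    refine (Finset.sum_le_card_nsmul _ _ (ENNReal.ofReal ((C * B) ^ q)) fun k _ => ?_).trans ?_
    · rw [← ENNReal.ofReal_rpow_of_nonneg (by positivity) hq0.le]
      exact ENNReal.rpow_le_rpow (h σ R hσ' hR s a hs w hw k) hq0.le
    · rw [nsmul_eq_mul, ← ENNReal.ofReal_natCast, ← ENNReal.ofReal_mul (by positivity)]
      refine ENNReal.ofReal_le_ofReal ?_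
      gcongr
      exact card_activeCaps_le hR
  refine (ENNReal.rpow_le_rpow h1 (by positivity)).trans ?_
  rw [ENNReal.ofReal_rpow_of_nonneg (by positivity) (by positivity)]
  refine ENNReal.ofReal_le_ofReal ?_
  rw [Real.mul_rpow (by positivity) (by positivity), Real.mul_rpow (by positivity) (by positivity),
    ← Real.rpow_mul (x := C * B) (by positivity), mul_one_div_cancel hq0.ne', Real.rpow_one]
  have h2 : ((5 : ℝ) ^ n) ^ (1 / q) ≤ 5 ^ n := by
    refine (Real.rpow_le_rpow_of_exponent_le (one_le_pow₀ (by norm_num))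
      ((div_le_one hq0).2 hq)).trans_eq (Real.rpow_one _)
  calc _ ≤ 5 ^ n * (R ^ ((n : ℝ) * σ)) ^ (1 / q) * (C * B) := by gcongr
    _ = _ := by ring

theorem le_capSum (hn : 1 ≤ n) (A : ℝ) (hA : 1 ≤ A) : ∃ c : ℝ, 0 < c ∧ ∀ σ R : ℝ, 0 < σ →
    σ < 1 / 2 → 1 < R → ∀ (s : ℝ) (a : Fin n → ℝ), IsCapSide R s →
    ∀ w : E (n + 1) → ℝ≥0∞, IsBallWeight n A R w → ∀ q : ℝ, 1 ≤ q →
      ENNReal.ofReal (c *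
        ((R ^ ((n : ℝ) * σ)) ^ (1 / q) * R ^ (-(n : ℝ) + ((n : ℝ) + 1) / pCrit n))) ≤
      capSum (hDensity n σ R) s a w q := by
  obtain ⟨c, hc, h⟩ := le_capNorm hn A hA
  refine ⟨(1 / 2) ^ n * c, by positivity, fun σ R hσ hσ' hR s a hs w hw q hq => ?_⟩
  have hR0 : 0 < R := by linarith
  have hq0 : 0 < q := by linarith
  set B := R ^ (-(n : ℝ) + ((n : ℝ) + 1) / pCrit n) with hB
  have hB0 : 0 < B := by positivity
  have h1 : ENNReal.ofReal ((1 / 2) ^ n * R ^ ((n : ℝ) * σ) * (c * B) ^ q) ≤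
      ∑' k, capNorm (hDensity n σ R) s a w k ^ q := by
    refine le_trans ?_ (ENNReal.sum_le_tsum ((freqs n σ R).image (capIndex σ R s a)))
    -- Only the caps assigned to boxes are kept; injectivity makes them as numerous as the boxes.
    rw [Finset.sum_image (capIndex_injective hσ' hR hs).injOn]
    refine le_trans ?_ (Finset.card_nsmul_le_sum _ _ (ENNReal.ofReal ((c * B) ^ q)) fun l hl => ?_)
    · rw [nsmul_eq_mul, ← ENNReal.ofReal_natCast, ← ENNReal.ofReal_mul (by positivity)]
      refine ENNReal.ofReal_le_ofReal ?_
      exact mul_le_mul_of_nonneg_right (le_card_freqs hσ hR) (by positivity)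
    · rw [← ENNReal.ofReal_rpow_of_nonneg (by positivity) hq0.le]
      exact ENNReal.rpow_le_rpow (h σ R hσ' hR s a hs w hw l hl) hq0.le
  refine le_trans ?_ (ENNReal.rpow_le_rpow h1 (by positivity))
  rw [ENNReal.ofReal_rpow_of_nonneg (by positivity) (by positivity)]
  refine ENNReal.ofReal_le_ofReal ?_
  rw [Real.mul_rpow (by positivity) (by positivity), Real.mul_rpow (by positivity) (by positivity),
    ← Real.rpow_mul (x := c * B) (by positivity), mul_one_div_cancel hq0.ne', Real.rpow_one]
  have h2 : ((1 / 2 : ℝ)) ^ n ≤ ((1 / 2 : ℝ) ^ n) ^ (1 / q) := by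
    refine (Real.rpow_one _).symm.trans_le (Real.rpow_le_rpow_of_exponent_ge (by positivity)
      (pow_le_one₀ (by norm_num) (by norm_num)) ((div_le_one hq0).2 hq))
  calc _ = (1 / 2) ^ n * (R ^ ((n : ℝ) * σ)) ^ (1 / q) * (c * B) := by ring
    _ ≤ _ := by gcongr

/-- The exponent agrees with that of `rpow_sharpExp` exactly because `p` is critical: comparing the
coefficients of `σ` requires `n - (n + 2)/p = n/2`. -/
theorem rpow_half_mul_capExp {σ R : ℝ} (hR : 1 < R) :
    (R ^ ((n : ℝ) * σ)) ^ (1 / 2 : ℝ) * R ^ (-(n : ℝ) + ((n : ℝ) + 1) / pCrit n) =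
      R ^ sharpExp n σ := by
  have hR0 : 0 < R := by linarith
  rw [← Real.rpow_mul hR0.le, ← Real.rpow_add hR0, sharpExp_eq, div_eq_mul_inv _ (pCrit n),
    pCrit_inv]
  congr 1
  field_simp; ring

end CapNorm

/-! ### Wave packets -/

section WavePackets

theorem Profile.exists_norm_le {d : ℕ} (φ : Profile d) : ∃ C : ℝ, 0 < C ∧ ∀ y, ‖φ.η y‖ ≤ C := by
  obtain ⟨C, hC, h⟩ := φ.η.decay 0 0
  exact ⟨C, hC, fun y => by simpa using h y⟩

theorem Profile.exists_le_norm {d : ℕ} (φ : Profile d) :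
    ∃ c : ℝ, 0 < c ∧ ∀ y : E d, (∀ i, |y i| ≤ 1 / 2) → c ≤ ‖φ.η y‖ := by
  have hK : IsCompact {y : E d | ∀ i, |y i| ≤ 1 / 2} := by
    refine Metric.isCompact_of_isClosed_isBounded ?_ ?_
    · simp only [ofPred_forall]
      exact isClosed_iInter fun i => isClosed_le (by fun_prop) continuous_const
    · refine (isBounded_iff_forall_norm_le).2 ⟨∑ _i : Fin d, 1 / 2, fun y hy => ?_⟩
      exact (norm_le_sum_abs y).trans (Finset.sum_le_sum fun i _ => hy i)
  obtain ⟨y₀, hy₀, hmin⟩ := hK.exists_isMinOn ⟨0, fun i => by simp⟩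
    (φ.η.continuous.norm.continuousOn)
  exact ⟨‖φ.η y₀‖, norm_pos_iff.2 (φ.ne_zero y₀ hy₀), fun y hy => hmin hy⟩

variable {n : ℕ} {σ R K s : ℝ} {a : Fin n → ℝ}

/-- The index of the tile through `x`. -/
noncomputable def tubeIndex (𝔅 : CapBoxes n R K s a) (k : Fin n → ℤ) (x : E (n + 1)) :
    Fin (n + 1) → ℤ :=
  fun i => ⌊𝔅.coord k x i + 1 / 2⌋

theorem mem_tube_iff {𝔅 : CapBoxes n R K s a} {k : Fin n → ℤ} {m : Fin (n + 1) → ℤ}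
    {x : E (n + 1)} : x ∈ 𝔅.tube k m ↔ tubeIndex 𝔅 k x = m := by
  rw [funext_iff]
  refine forall_congr' fun i => ?_
  rw [tubeIndex, Int.floor_eq_iff, mem_Ico]
  constructor <;> rintro ⟨h1, h2⟩ <;> constructor <;> linarith

theorem magnitude_le {φ : Profile (n + 1)} {C : ℝ} (hC : ∀ y, ‖φ.η y‖ ≤ C)
    {f : E (n + 1) → ℝ} {D : ℝ} {k : Fin n → ℤ} (hD : ∀ x, ‖capPart f s a k x‖ ≤ D)
    (𝔅 : CapBoxes n R K s a) (m : Fin (n + 1) → ℤ) :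
    magnitude φ 𝔅 f k m ≤ ENNReal.ofReal (C * D) := by
  refine iSup₂_le fun x _ => ?_
  rw [← ofReal_norm, wavePacket, norm_mul]
  exact ENNReal.ofReal_le_ofReal
    (mul_le_mul (hC _) (hD x) (norm_nonneg _) ((norm_nonneg _).trans (hC 0)))

theorem le_magnitude {φ : Profile (n + 1)} {c : ℝ} (hc0 : 0 ≤ c)
    (hc : ∀ y : E (n + 1), (∀ i, |y i| ≤ 1 / 2) → c ≤ ‖φ.η y‖) {f : E (n + 1) → ℝ} {D : ℝ}
    {𝔅 : CapBoxes n R K s a} {k : Fin n → ℤ} {m : Fin (n + 1) → ℤ} {x : E (n + 1)}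
    (hx : x ∈ 𝔅.tube k m) (hD : D ≤ ‖capPart f s a k x‖) :
    ENNReal.ofReal (c * D) ≤ magnitude φ 𝔅 f k m := by
  refine le_trans ?_ (le_iSup₂ x hx)
  rw [← ofReal_norm, wavePacket, norm_mul]
  refine ENNReal.ofReal_le_ofReal ((mul_le_mul_of_nonneg_left hD hc0).trans
    (mul_le_mul_of_nonneg_right (hc _ fun i => ?_) (norm_nonneg _)))
  have h1 := hx i
  simp only [PiLp.sub_apply, intVec, abs_le]
  constructor <;> linarith [h1.1, h1.2]

/-- The tiles of one cap partition space, so a cap contributes at most one packet through `x`; a cap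
outside `activeCaps` has zero packets, which `lam > 0` excludes. -/
theorem encard_packetsAt_le (hR : 1 < R) (hs : IsCapSide R s) (φ : Profile (n + 1))
    (𝔅 : CapBoxes n R K s a) {lam : ℝ} (hlam : 0 < lam) (x : E (n + 1)) :
    ((packetsAt φ 𝔅 (hDensity n σ R) lam x).encard : ℝ≥0∞) ≤
      ENNReal.ofReal (5 ^ n * R ^ ((n : ℝ) * σ)) := by
  classical
  have hsub : packetsAt φ 𝔅 (hDensity n σ R) lam x ⊆
      (((activeCaps σ R s a).image fun k => (k, tubeIndex 𝔅 k x) : Finset _) : Set _) := by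
    rintro ⟨k, m⟩ ⟨-, hx, hm⟩
    rw [Finset.mem_coe, Finset.mem_image]
    refine ⟨k, ?_, by rw [mem_tube_iff.1 hx]⟩
    by_contra hk
    have h0 : magnitude φ 𝔅 (hDensity n σ R) k m = 0 := by
      simp [magnitude, wavePacket, capPart_eq_zero hR hs hk]
    have := hm.trans_eq h0
    simp only [nonpos_iff_eq_zero, ENNReal.ofReal_eq_zero] at this
    linarith
  have h1 := encard_le_encard hsub
  rw [encard_coe_eq_coe_finsetCard] at h1
  have h2 : ((packetsAt φ 𝔅 (hDensity n σ R) lam x).encard : ℝ≥0∞) ≤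
      ((activeCaps σ R s a).card : ℝ≥0∞) := by
    refine (ENat.toENNReal_le.2 h1).trans ?_
    rw [ENat.toENNReal_coe]
    exact_mod_cast Finset.card_image_le
  refine h2.trans ?_
  rw [← ENNReal.ofReal_natCast]
  exact ENNReal.ofReal_le_ofReal (card_activeCaps_le hR)

/-- For every `l`, the cap `capIndex l` has `|g_θ(y)| ≳ R^{-n}`, and its tile through `y` records
this value in the magnitude. -/
theorem le_encard_packetsAt (hσ : 0 < σ) (hσ' : σ < 1 / 2) (hR : 1 < R) (hs : IsCapSide R s)
    {φ : Profile (n + 1)} {c : ℝ} (hc0 : 0 ≤ c)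
    (hc : ∀ y : E (n + 1), (∀ i, |y i| ≤ 1 / 2) → c ≤ ‖φ.η y‖) (𝔅 : CapBoxes n R K s a)
    {lam : ℝ} (hlam : lam ≤ c * ((1 / 2) * ((1 / 4) ^ n * R ^ (-(n : ℝ))))) {y : E (n + 1)}
    (hy : y ∈ lattice n σ R) (hyR : ‖y‖ ≤ phaseRadius n * R) :
    ENNReal.ofReal ((1 / 2) ^ n * R ^ ((n : ℝ) * σ)) ≤
      ((packetsAt φ 𝔅 (hDensity n σ R) lam y).encard : ℝ≥0∞) := by
  classical
  set ι : (Fin n → ℤ) → (Fin n → ℤ) × (Fin (n + 1) → ℤ) := fun l =>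
    (capIndex σ R s a l, tubeIndex 𝔅 (capIndex σ R s a l) y) with hι
  have hinj : Function.Injective ι := fun l l' h =>
    capIndex_injective hσ' hR hs (congrArg Prod.fst h)
  have hsub : (((freqs n σ R).image ι : Finset _) : Set _) ⊆
      packetsAt φ 𝔅 (hDensity n σ R) lam y := by
    intro q hq
    rw [Finset.mem_coe, Finset.mem_image] at hq
    obtain ⟨l, hl, rfl⟩ := hq
    have hmem : y ∈ 𝔅.tube (ι l).1 (ι l).2 := mem_tube_iff.2 rfl
    refine ⟨⟨y, hmem, mem_ball_zero_iff.2 ?_⟩, hmem, ?_⟩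
    · have := phaseRadius_le n
      nlinarith
    · exact (ENNReal.ofReal_le_ofReal hlam).trans
        (le_magnitude hc0 hc hmem (le_norm_capPart_of_lattice hσ' hR hs hl hy hyR))
  have h1 := encard_le_encard hsub
  rw [encard_coe_eq_coe_finsetCard, Finset.card_image_of_injective _ hinj] at h1
  refine le_trans ?_ (ENat.toENNReal_le.2 h1)
  rw [ENat.toENNReal_coe, ← ENNReal.ofReal_natCast]
  exact ENNReal.ofReal_le_ofReal (le_card_freqs hσ hR)

theorem zero_mem_X (hR : 1 < R) : (0 : E (n + 1)) ∈ X n σ R :=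
  ⟨Metric.mem_thickening_iff.2 ⟨0, zero_mem_lattice, by simp⟩, Metric.mem_ball_self (by linarith)⟩

theorem multiplicity_le (hR : 1 < R) (hs : IsCapSide R s) (φ : Profile (n + 1))
    (𝔅 : CapBoxes n R K s a) {lam : ℝ} (hlam : 0 < lam) :
    multiplicity φ 𝔅 (hDensity n σ R) lam (X n σ R) ≤
      ENNReal.ofReal (5 ^ n * R ^ ((n : ℝ) * σ)) :=
  iSup₂_le fun x _ => encard_packetsAt_le hR hs φ 𝔅 hlam x

theorem le_multiplicity (hσ : 0 < σ) (hσ' : σ < 1 / 2) (hR : 1 < R) (hs : IsCapSide R s)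
    {φ : Profile (n + 1)} {c : ℝ} (hc0 : 0 ≤ c)
    (hc : ∀ y : E (n + 1), (∀ i, |y i| ≤ 1 / 2) → c ≤ ‖φ.η y‖) (𝔅 : CapBoxes n R K s a)
    {lam : ℝ} (hlam : lam ≤ c * ((1 / 2) * ((1 / 4) ^ n * R ^ (-(n : ℝ))))) :
    ENNReal.ofReal ((1 / 2) ^ n * R ^ ((n : ℝ) * σ)) ≤
      multiplicity φ 𝔅 (hDensity n σ R) lam (X n σ R) := by
  refine (le_encard_packetsAt hσ hσ' hR hs hc0 hc 𝔅 hlam zero_mem_lattice ?_).trans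
    (le_iSup₂ (f := fun x (_ : x ∈ X n σ R) =>
      ((packetsAt φ 𝔅 (hDensity n σ R) lam x).encard : ℝ≥0∞)) 0 (zero_mem_X hR))
  have := phaseRadius_pos n
  rw [norm_zero]; positivity

/-- The powers of `R` in the right-hand side of refined decoupling, for a multiplicity
`C₁ R^{(d-1)σ}` and a sum of norms of size `C₂`. -/
theorem ofReal_refined_eq (hn : 1 ≤ n) (hR : 1 < R) {C₁ C₂ : ℝ} (hC₁ : 0 < C₁) (ε : ℝ) :
    ENNReal.ofReal (R ^ ε) *
        ENNReal.ofReal (C₁ * R ^ ((n : ℝ) * σ)) ^ (1 / 2 - 1 / pCrit n) *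
        ENNReal.ofReal (C₂ * ((R ^ ((n : ℝ) * σ)) ^ (1 / pCrit n) *
          R ^ (-(n : ℝ) + ((n : ℝ) + 1) / pCrit n))) =
      ENNReal.ofReal (C₁ ^ (1 / 2 - 1 / pCrit n) * C₂ * R ^ (sharpExp n σ + ε)) := by
  have hR0 : 0 < R := by linarith
  have hpos : 0 < R ^ ((n : ℝ) * σ) := by positivity
  have hp : 0 ≤ 1 / 2 - 1 / pCrit n :=
    sub_nonneg.2 (one_div_le_one_div_of_le two_pos (two_lt_pCrit hn).le)
  rw [ENNReal.ofReal_rpow_of_nonneg (by positivity) hp, ← ENNReal.ofReal_mul (by positivity),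
    ← ENNReal.ofReal_mul (by positivity), Real.mul_rpow hC₁.le hpos.le,
    Real.rpow_add hR0 (sharpExp n σ),
    ← rpow_half_mul_capExp hR]
  congr 1
  -- The multiplicity supplies the power `1/2 - 1/p` and the `ℓ^p` sum the power `1/p`; together
  -- they give the `ℓ²` count.
  have h : (R ^ ((n : ℝ) * σ)) ^ (1 / 2 : ℝ) =
      (R ^ ((n : ℝ) * σ)) ^ (1 / 2 - 1 / pCrit n) * (R ^ ((n : ℝ) * σ)) ^ (1 / pCrit n) := by
    rw [← Real.rpow_add hpos, sub_add_cancel]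
  rw [h]; ring

end WavePackets

/-! ### The three groups of estimates -/

theorem exists_const_g {n : ℕ} (hn : 1 ≤ n) :
    ∃ C : ℝ, 1 ≤ C ∧ ∀ σ R : ℝ, 0 < σ → σ < 1 / 2 → 1 < R →
      (∀ x, ‖g n σ R x‖ ≤ C * R ^ ((n : ℝ) * (σ - 1))) ∧
      (∀ y ∈ lattice n σ R, ‖y‖ < C⁻¹ * R → ∀ x, dist x y ≤ C⁻¹ →
        C⁻¹ * R ^ ((n : ℝ) * (σ - 1)) ≤ ‖g n σ R x‖) ∧
      Comparable C (volume (X n σ R)) (R ^ (((n : ℝ) + 1) - ((n : ℝ) + 2) * σ)) ∧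
      Comparable C (lpOn (g n σ R) (X n σ R)) (R ^ sharpExp n σ) := by
  obtain ⟨CX, hCX, hX⟩ := volume_X_le n
  obtain ⟨cX, hcX, hX'⟩ := le_volume_nearLattice n
  obtain ⟨Cg, hCg, hg⟩ := lpOn_g_le hn
  obtain ⟨cg, hcg, hg'⟩ := le_lpOn_g hn
  have hr := inv_pos.2 (phaseRadius_pos n)
  have hhalf : (0 : ℝ) < (1 / 2) ^ (n + 1) := by positivity
  have hup : (0 : ℝ) < (1 + 4 * n) * 2 ^ n := by positivity
  have := inv_pos.2 hhalf
  have := inv_pos.2 hcX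
  have := inv_pos.2 hcg
  -- A sum of positive terms dominates each of them, so one `C` serves all the upper constants and
  -- the inverses of all the lower ones.
  set C := 1 + (phaseRadius n)⁻¹ + (1 + 4 * n) * 2 ^ n + ((1 / 2 : ℝ) ^ (n + 1))⁻¹ + CX + cX⁻¹ +
    Cg + cg⁻¹ with hC
  have hCr : C⁻¹ ≤ phaseRadius n := inv_le_of_inv_le₀ (phaseRadius_pos n) (by linarith)
  have hCh : C⁻¹ ≤ (1 / 2 : ℝ) ^ (n + 1) := inv_le_of_inv_le₀ hhalf (by linarith)
  refine ⟨C, by linarith, fun σ R hσ hσ' hR => ?_⟩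
  have hR0 : 0 < R := by linarith
  refine ⟨fun x => (norm_g_le hR x).trans ?_, fun y hy hyR x hx => ?_, ?_, ?_⟩
  · gcongr; linarith
  · refine le_trans ?_ (le_norm_g hσ hσ' hR hy (hyR.le.trans ?_) (hx.trans hCr))
    all_goals gcongr
  · exact Comparable.of_le hcX (by positivity)
      ((hX' σ R hσ hR).trans (measure_mono (nearLattice_subset_X hσ hR))) (hX σ R hσ hσ' hR)
      (by linarith) (by linarith)
  · exact Comparable.of_le hcg (by positivity) (hg' σ R hσ hσ' hR) (hg σ R hσ hσ' hR)
      (by linarith) (by linarith)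

theorem exists_const_capPart {n : ℕ} (hn : 1 ≤ n) (A : ℝ) (hA : 1 ≤ A) :
    ∃ C : ℝ, 1 ≤ C ∧ ∀ σ R : ℝ, 0 < σ → σ < 1 / 2 → 1 < R →
      ∀ (s : ℝ) (a : Fin n → ℝ), IsCapSide R s →
      ∀ w : E (n + 1) → ℝ≥0∞, IsBallWeight n A R w →
      (∀ k x, ‖capPart (hDensity n σ R) s a k x‖ ≤ C * R ^ (-(n : ℝ))) ∧
      (∀ k, capNorm (hDensity n σ R) s a w k ≤
        ENNReal.ofReal (C * R ^ (-(n : ℝ) + ((n : ℝ) + 1) / pCrit n))) ∧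
      (IsAdapted n σ R s a → ∀ k, capPart (hDensity n σ R) s a k ≠ 0 →
        (∀ x, ‖x‖ < C⁻¹ * R →
          C⁻¹ * R ^ (-(n : ℝ)) ≤ ‖capPart (hDensity n σ R) s a k x‖) ∧
        Comparable C (capNorm (hDensity n σ R) s a w k)
          (R ^ (-(n : ℝ) + ((n : ℝ) + 1) / pCrit n))) ∧
      Comparable C (capSum (hDensity n σ R) s a w 2) (R ^ sharpExp n σ) ∧
      capSum (hDensity n σ R) s a w 2 ≤
        ENNReal.ofReal C * lpOn (g n σ R) (Metric.ball 0 R) := by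
  obtain ⟨Cn, hCn, hN⟩ := capNorm_le hn A hA
  obtain ⟨cn, hcn, hN'⟩ := le_capNorm hn A hA
  obtain ⟨Cs, hCs, hS⟩ := capSum_le hn A hA
  obtain ⟨cs, hcs, hS'⟩ := le_capSum hn A hA
  obtain ⟨cg, hcg, hg'⟩ := le_lpOn_g hn
  have hr := inv_pos.2 (phaseRadius_pos n)
  have hlow : (0 : ℝ) < (1 / 2) * (1 / 4) ^ n := by positivity
  have hup : (0 : ℝ) < 3 ^ n * ((1 + 4 * n) * 2 ^ n) := by positivity
  have := inv_pos.2 hlow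
  have := inv_pos.2 hcn
  have := inv_pos.2 hcs
  have : 0 < Cs * cg⁻¹ := by positivity
  set C := 1 + (phaseRadius n)⁻¹ + 3 ^ n * ((1 + 4 * n) * 2 ^ n) + ((1 / 2 : ℝ) * (1 / 4) ^ n)⁻¹ +
    Cn + cn⁻¹ + Cs + cs⁻¹ + Cs * cg⁻¹ with hC
  have hCr : C⁻¹ ≤ phaseRadius n := inv_le_of_inv_le₀ (phaseRadius_pos n) (by linarith)
  have hCl : C⁻¹ ≤ (1 / 2 : ℝ) * (1 / 4) ^ n := inv_le_of_inv_le₀ hlow (by linarith)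
  refine ⟨C, by linarith, fun σ R hσ hσ' hR s a hs w hw => ?_⟩
  have hR0 : 0 < R := by linarith
  have hNk := hN σ R hσ' hR s a hs w hw
  have hS2 := hS σ R hσ' hR s a hs w hw 2 one_le_two
  have hS2' := hS' σ R hσ hσ' hR s a hs w hw 2 one_le_two
  rw [rpow_half_mul_capExp hR] at hS2 hS2'
  refine ⟨fun k x => (norm_capPart_le hσ' hR hs k x).trans ?_, fun k => (hNk k).trans ?_,
    fun had k hk => ⟨fun x hx => ?_, ?_⟩, ?_, ?_⟩
  · gcongr; linarith
  · gcongr; linarith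
  · refine le_trans ?_ (had.le_norm_capPart hσ' hR hs hk (hx.le.trans ?_))
    · rw [← mul_assoc]; gcongr
    · exact mul_le_mul_of_nonneg_right hCr hR0.le
  · obtain ⟨l, hl, rfl, -⟩ := had.exists_unique_freq hσ' hR hs hk
    exact Comparable.of_le hcn (by positivity) (hN' σ R hσ' hR s a hs w hw l hl) (hNk _)
      (by linarith) (by linarith)
  · exact Comparable.of_le hcs (by positivity) hS2' hS2 (by linarith) (by linarith)
  · calc _ ≤ ENNReal.ofReal (Cs * R ^ sharpExp n σ) := hS2
      _ = ENNReal.ofReal (Cs * cg⁻¹) * ENNReal.ofReal (cg * R ^ sharpExp n σ) := by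
          rw [← ENNReal.ofReal_mul (by positivity)]
          congr 1; field_simp
      _ ≤ ENNReal.ofReal C * lpOn (g n σ R) (Metric.ball 0 R) := by
          refine mul_le_mul' (ENNReal.ofReal_le_ofReal (by linarith))
            ((hg' σ R hσ hσ' hR).trans (eLpNorm_mono_measure _ ?_))
          exact Measure.restrict_mono inter_subset_right le_rfl

theorem exists_const_wavePacket {n : ℕ} (hn : 1 ≤ n) (A : ℝ) (φ : Profile (n + 1)) (hA : 1 ≤ A) :
    ∃ C : ℝ, 1 ≤ C ∧ ∀ σ R : ℝ, 0 < σ → σ < 1 / 2 → 1 < R →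
      ∀ (K s : ℝ) (a : Fin n → ℝ), IsCapSide R s →
      ∀ (𝔅 : CapBoxes n R K s a) (w : E (n + 1) → ℝ≥0∞), IsBallWeight n A R w →
      (∀ k m, magnitude φ 𝔅 (hDensity n σ R) k m ≤ ENNReal.ofReal (C * R ^ (-(n : ℝ)))) ∧
      (IsAdapted n σ R s a → ∀ k m, capPart (hDensity n σ R) s a k ≠ 0 →
        (𝔅.tube k m ∩ Metric.ball 0 (C⁻¹ * R)).Nonempty →
        ENNReal.ofReal (C⁻¹ * R ^ (-(n : ℝ))) ≤ magnitude φ 𝔅 (hDensity n σ R) k m) ∧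
      ∀ lam : ℝ, 0 < lam → lam ≤ C⁻¹ * R ^ (-(n : ℝ)) →
        (∀ y ∈ lattice n σ R, ‖y‖ < C⁻¹ * R →
          ENNReal.ofReal (C⁻¹ * R ^ ((n : ℝ) * σ)) ≤
            ((packetsAt φ 𝔅 (hDensity n σ R) lam y).encard : ℝ≥0∞)) ∧
        Comparable C (multiplicity φ 𝔅 (hDensity n σ R) lam (X n σ R)) (R ^ ((n : ℝ) * σ)) ∧
        ∀ ε : ℝ,
          Comparable C (refinedRHS φ 𝔅 (hDensity n σ R) lam (X n σ R) w ε)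
            (R ^ (sharpExp n σ + ε)) ∧
          refinedRHS φ 𝔅 (hDensity n σ R) lam (X n σ R) w ε ≤
            ENNReal.ofReal (C * R ^ ε) * lpOn (g n σ R) (X n σ R) := by
  obtain ⟨Cs, hCs, hS⟩ := capSum_le hn A hA
  obtain ⟨cs, hcs, hS'⟩ := le_capSum hn A hA
  obtain ⟨cg, hcg, hg'⟩ := le_lpOn_g hn
  obtain ⟨Cη, hCη, hη⟩ := φ.exists_norm_le
  obtain ⟨cη, hcη, hη'⟩ := φ.exists_le_norm
  have hp : 0 ≤ 1 / 2 - 1 / pCrit n :=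
    sub_nonneg.2 (one_div_le_one_div_of_le two_pos (two_lt_pCrit hn).le)
  have hr := inv_pos.2 (phaseRadius_pos n)
  have hlow : (0 : ℝ) < cη * ((1 / 2) * (1 / 4) ^ n) := by positivity
  have hup : (0 : ℝ) < Cη * (3 ^ n * ((1 + 4 * n) * 2 ^ n)) := by positivity
  have h5 : (0 : ℝ) < 5 ^ n := by positivity
  have h2 : (0 : ℝ) < (1 / 2) ^ n := by positivity
  have hrl : 0 < ((1 / 2 : ℝ) ^ n) ^ (1 / 2 - 1 / pCrit n) * cs := by positivity
  have hru : 0 < ((5 : ℝ) ^ n) ^ (1 / 2 - 1 / pCrit n) * Cs := by positivity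
  have := inv_pos.2 hlow
  have := inv_pos.2 h2
  have := inv_pos.2 hrl
  have : 0 < ((5 : ℝ) ^ n) ^ (1 / 2 - 1 / pCrit n) * Cs * cg⁻¹ := by positivity
  set C := 1 + (phaseRadius n)⁻¹ + Cη * (3 ^ n * ((1 + 4 * n) * 2 ^ n)) +
    (cη * ((1 / 2) * (1 / 4) ^ n))⁻¹ + 5 ^ n + ((1 / 2 : ℝ) ^ n)⁻¹ +
    (((1 / 2 : ℝ) ^ n) ^ (1 / 2 - 1 / pCrit n) * cs)⁻¹ +
    ((5 : ℝ) ^ n) ^ (1 / 2 - 1 / pCrit n) * Cs +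
    ((5 : ℝ) ^ n) ^ (1 / 2 - 1 / pCrit n) * Cs * cg⁻¹ with hC
  have hCr : C⁻¹ ≤ phaseRadius n := inv_le_of_inv_le₀ (phaseRadius_pos n) (by linarith)
  have hCl : C⁻¹ ≤ cη * ((1 / 2) * (1 / 4) ^ n) := inv_le_of_inv_le₀ hlow (by linarith)
  have hCh : C⁻¹ ≤ (1 / 2 : ℝ) ^ n := inv_le_of_inv_le₀ h2 (by linarith)
  refine ⟨C, by linarith, fun σ R hσ hσ' hR K s a hs 𝔅 w hw => ?_⟩
  have hR0 : 0 < R := by linarith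
  have hlow' : C⁻¹ * R ^ (-(n : ℝ)) ≤ cη * ((1 / 2) * ((1 / 4) ^ n * R ^ (-(n : ℝ)))) := by
    calc _ ≤ cη * ((1 / 2) * (1 / 4) ^ n) * R ^ (-(n : ℝ)) := by gcongr
      _ = _ := by ring
  refine ⟨fun k m => (magnitude_le hη (norm_capPart_le hσ' hR hs k) 𝔅 m).trans ?_,
    fun had k m hk hne => ?_, fun lam hlam0 hlam => ⟨fun y hy hyR => ?_, ?_, fun ε => ?_⟩⟩
  · rw [← mul_assoc]
    gcongr; linarith
  · obtain ⟨x, hx, hxR⟩ := hne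
    refine (ENNReal.ofReal_le_ofReal hlow').trans (le_magnitude hcη.le hη' hx
      (had.le_norm_capPart hσ' hR hs hk ?_))
    exact (mem_ball_zero_iff.1 hxR).le.trans (mul_le_mul_of_nonneg_right hCr hR0.le)
  · refine le_trans ?_ (le_encard_packetsAt hσ hσ' hR hs hcη.le hη' 𝔅 (hlam.trans hlow') hy
      (hyR.le.trans (mul_le_mul_of_nonneg_right hCr hR0.le)))
    gcongr
  · exact Comparable.of_le h2 (by positivity)
      (le_multiplicity hσ hσ' hR hs hcη.le hη' 𝔅 (hlam.trans hlow'))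
      (multiplicity_le hR hs φ 𝔅 hlam0) (by linarith) (by linarith)
  · have hp1 : 1 ≤ pCrit n := by linarith [two_lt_pCrit hn]
    have hM := multiplicity_le (σ := σ) hR hs φ 𝔅 hlam0
    have hM' := le_multiplicity hσ hσ' hR hs hcη.le hη' 𝔅 (hlam.trans hlow')
    have hSp := hS σ R hσ' hR s a hs w hw (pCrit n) hp1
    have hSp' := hS' σ R hσ hσ' hR s a hs w hw (pCrit n) hp1
    have hU : refinedRHS φ 𝔅 (hDensity n σ R) lam (X n σ R) w ε ≤ ENNReal.ofReal
        (((5 : ℝ) ^ n) ^ (1 / 2 - 1 / pCrit n) * Cs * R ^ (sharpExp n σ + ε)) := by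
      rw [← ofReal_refined_eq hn hR h5]
      exact mul_le_mul' (mul_le_mul' le_rfl (ENNReal.rpow_le_rpow hM hp)) hSp
    have hL : ENNReal.ofReal
        (((1 / 2 : ℝ) ^ n) ^ (1 / 2 - 1 / pCrit n) * cs * R ^ (sharpExp n σ + ε)) ≤
        refinedRHS φ 𝔅 (hDensity n σ R) lam (X n σ R) w ε := by
      rw [← ofReal_refined_eq hn hR h2]
      exact mul_le_mul' (mul_le_mul' le_rfl (ENNReal.rpow_le_rpow hM' hp)) hSp'
    refine ⟨Comparable.of_le hrl (by positivity) hL hU (by linarith) (by linarith), ?_⟩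
    calc _ ≤ _ := hU
      _ = ENNReal.ofReal (((5 : ℝ) ^ n) ^ (1 / 2 - 1 / pCrit n) * Cs * cg⁻¹ * R ^ ε) *
          ENNReal.ofReal (cg * R ^ sharpExp n σ) := by
          rw [← ENNReal.ofReal_mul (by positivity), Real.rpow_add hR0]
          congr 1; field_simp
      _ ≤ _ := by
          refine mul_le_mul' (ENNReal.ofReal_le_ofReal ?_) (hg' σ R hσ hσ' hR)
          gcongr
          linarith

end BBCRV

/-! ### The complete theorem -/

theorem mainTheorem1 (n : ℕ) (hn : 1 ≤ n) :
    -- size of `g`, measure of `X`, and the left-hand side of refined decoupling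
    (∃ C : ℝ, 1 ≤ C ∧ ∀ σ R : ℝ, 0 < σ → σ < 1 / 2 → 1 < R →
      (∀ x, ‖BBCRV.g n σ R x‖ ≤ C * R ^ ((n : ℝ) * (σ - 1))) ∧
      (∀ y ∈ BBCRV.lattice n σ R, ‖y‖ < C⁻¹ * R → ∀ x, dist x y ≤ C⁻¹ →
        C⁻¹ * R ^ ((n : ℝ) * (σ - 1)) ≤ ‖BBCRV.g n σ R x‖) ∧
      BBCRV.Comparable C (MeasureTheory.volume (BBCRV.X n σ R))
        (R ^ (((n : ℝ) + 1) - ((n : ℝ) + 2) * σ)) ∧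
      BBCRV.Comparable C (BBCRV.lpOn (BBCRV.g n σ R) (BBCRV.X n σ R))
        (R ^ BBCRV.sharpExp n σ)) ∧
    -- the functions `g_θ`, and sharpness for Bourgain–Demeter decoupling
    (∀ A : ℝ, 1 ≤ A → ∃ C : ℝ, 1 ≤ C ∧ ∀ σ R : ℝ, 0 < σ → σ < 1 / 2 → 1 < R →
      ∀ (s : ℝ) (a : Fin n → ℝ), BBCRV.IsCapSide R s →
      ∀ w : BBCRV.E (n + 1) → ENNReal, BBCRV.IsBallWeight n A R w →
      (∀ k x, ‖BBCRV.capPart (BBCRV.hDensity n σ R) s a k x‖ ≤ C * R ^ (-(n : ℝ))) ∧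
      (∀ k, BBCRV.capNorm (BBCRV.hDensity n σ R) s a w k ≤
        ENNReal.ofReal (C * R ^ (-(n : ℝ) + ((n : ℝ) + 1) / BBCRV.pCrit n))) ∧
      (BBCRV.IsAdapted n σ R s a → ∀ k, BBCRV.capPart (BBCRV.hDensity n σ R) s a k ≠ 0 →
        (∀ x, ‖x‖ < C⁻¹ * R →
          C⁻¹ * R ^ (-(n : ℝ)) ≤ ‖BBCRV.capPart (BBCRV.hDensity n σ R) s a k x‖) ∧
        BBCRV.Comparable C (BBCRV.capNorm (BBCRV.hDensity n σ R) s a w k)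
          (R ^ (-(n : ℝ) + ((n : ℝ) + 1) / BBCRV.pCrit n))) ∧
      BBCRV.Comparable C (BBCRV.capSum (BBCRV.hDensity n σ R) s a w 2)
        (R ^ BBCRV.sharpExp n σ) ∧
      BBCRV.capSum (BBCRV.hDensity n σ R) s a w 2 ≤
        ENNReal.ofReal C * BBCRV.lpOn (BBCRV.g n σ R) (Metric.ball 0 R)) ∧
    -- wave packets, the multiplicity `M`, and the right-hand side of refined decoupling
    (∀ (A : ℝ) (φ : BBCRV.Profile (n + 1)), 1 ≤ A → ∃ C : ℝ, 1 ≤ C ∧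
      ∀ σ R : ℝ, 0 < σ → σ < 1 / 2 → 1 < R →
      ∀ (K s : ℝ) (a : Fin n → ℝ), 1 ≤ K → BBCRV.IsCapSide R s →
      ∀ (𝔅 : BBCRV.CapBoxes n R K s a) (w : BBCRV.E (n + 1) → ENNReal),
      BBCRV.IsBallWeight n A R w →
      (∀ k m, BBCRV.magnitude φ 𝔅 (BBCRV.hDensity n σ R) k m ≤
        ENNReal.ofReal (C * R ^ (-(n : ℝ)))) ∧
      (BBCRV.IsAdapted n σ R s a → ∀ k m, BBCRV.capPart (BBCRV.hDensity n σ R) s a k ≠ 0 →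
        (𝔅.tube k m ∩ Metric.ball 0 (C⁻¹ * R)).Nonempty →
        ENNReal.ofReal (C⁻¹ * R ^ (-(n : ℝ))) ≤
          BBCRV.magnitude φ 𝔅 (BBCRV.hDensity n σ R) k m) ∧
      ∀ lam : ℝ, 0 < lam → lam ≤ C⁻¹ * R ^ (-(n : ℝ)) →
        (∀ y ∈ BBCRV.lattice n σ R, ‖y‖ < C⁻¹ * R →
          ENNReal.ofReal (C⁻¹ * R ^ ((n : ℝ) * σ)) ≤
            ((BBCRV.packetsAt φ 𝔅 (BBCRV.hDensity n σ R) lam y).encard : ENNReal)) ∧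
        BBCRV.Comparable C
          (BBCRV.multiplicity φ 𝔅 (BBCRV.hDensity n σ R) lam (BBCRV.X n σ R))
          (R ^ ((n : ℝ) * σ)) ∧
        ∀ ε : ℝ,
          BBCRV.Comparable C
            (BBCRV.refinedRHS φ 𝔅 (BBCRV.hDensity n σ R) lam (BBCRV.X n σ R) w ε)
            (R ^ (BBCRV.sharpExp n σ + ε)) ∧
          BBCRV.refinedRHS φ 𝔅 (BBCRV.hDensity n σ R) lam (BBCRV.X n σ R) w ε ≤
            ENNReal.ofReal (C * R ^ ε) * BBCRV.lpOn (BBCRV.g n σ R) (BBCRV.X n σ R)) ∧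
    -- grids of caps adapted to `g` exist
    (∀ σ R : ℝ, 0 < σ → σ < 1 / 2 → 16 ≤ R →
      ∃ (s : ℝ) (a : Fin n → ℝ), BBCRV.IsCapSide R s ∧ BBCRV.IsAdapted n σ R s a) := by
  refine ⟨BBCRV.exists_const_g hn, BBCRV.exists_const_capPart hn, fun A φ hA => ?_,
    fun σ R _ hσ' hR => BBCRV.exists_isAdapted hσ' hR⟩
  obtain ⟨C, hC, h⟩ := BBCRV.exists_const_wavePacket hn A φ hA
  exact ⟨C, hC, fun σ R hσ hσ' hR K s a _ => h σ R hσ hσ' hR K s a⟩
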